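/- Let $\mathbb{S}^2\subset\mathbb{R}^3$ be the unit sphere with surface area measure $\lambda$ (so $\lambda(\mathbb{S}^2)=4\pi$) and geodesic distance $d$, and let $B(\mathbf{x},r)=\{\mathbf{y}: d(\mathbf{x},\mathbf{y})\le r\}$. Let $\rho:\mathbb{S}^2\to\mathbb{R}_+$ be measurable and integrable with $\bar\rho=\inf_{\mathbf{x}}\rho(\mathbf{x})>0$, put $\mu(B)=\int_B\rho\,d\lambda$ and $\Lambda=\mu(\mathbb{S}^2)$, and let $X$ be a Poisson process on $\mathbb{S}^2$ with intensity function $\rho$. Let $P\subset\mathbb{S}^2$ be a finite non-empty grid and $r\in[0,\pi]$. Define the estimators $$\hat K(r)=\frac1{4\pi}\sum_{\mathbf{x}\in X}\sum_{\mathbf{y}\in X\setminus\{\mathbf{x}\}}\frac{\mathbf 1[d(\mathbf{x},\mathbf{y})\le r]}{\rho(\mathbf{x})\rho(\mathbf{y})},\qquad \hat F(r)=1-\frac1{|P|}\sum_{\mathbf{p}\in P}\ \prod_{\mathbf{x}\in X\cap B(\mathbf{p},r)}\Big(1-\frac{\bar\rho}{\rho(\mathbf{x})}\Big),$$ $$\hat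 H_e(r)=1-\frac1{|X|}\sum_{\mathbf{x}\in X}\ \prod_{\mathbf{y}\in X\setminus\{\mathbf{x}\}}\Big(1-\frac{\bar\rho\,\mathbf 1[\mathbf{y}\in B(\mathbf{x},r)]}{\rho(\mathbf{y})}\Big)\ \text{ if }X\ne\emptyset,\qquad \hat H_e(r)=e\ \text{ if }X=\emptyset .$$ Then $\hat K(r)$, $\hat F(r)$, $\hat H_0(r)$ and $\hat H_1(r)$ are square integrable, the integrals below converge absolutely, and the following hold. (1) $$\operatorname{Var}\hat K(r)=\frac1{8\pi^2}\int_{\mathbb{S}^2}\int_{\mathbb{S}^2}\frac{\mathbf 1[d(\mathbf{x},\mathbf{y})\le r]}{\rho(\mathbf{x})\rho(\mathbf{y})}\,\lambda(d\mathbf{x})\lambda(d\mathbf{y})+(1-\cos r)^2\int_{\mathbb{S}^2}\frac{1}{\rho(\mathbf{x})}\,\lambda(d\mathbf{x}).$$ (2) For any $\mathbf{o}\in\mathbb{S}^2$, $$\operatorname{Var}\hat F(r)=\frac{e^{-2\bar\rho\lambda(B(\mathbf{o},r))}}{|P|^2}\bigg(\sum_{\mathbf{p}\in P}\sum_{\mathbf{p}'\in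 P}\exp\Big(\int_{B(\mathbf{p},r)\cap B(\mathbf{p}',r)}\frac{\bar\rho^2}{\rho(\mathbf{x})}\,\lambda(d\mathbf{x})\Big)\bigg)-e^{-2\bar\rho\lambda(B(\mathbf{o},r))}.$$ (3) Let $C=1-\frac{\bar\rho}{\Lambda}2\pi(1-\cos r)$ and $$A_1(\mathbf{x},\mathbf{y})=1-\frac{2\bar\rho}{\Lambda}2\pi(1-\cos r)+\frac{\bar\rho^2}{\Lambda}\int_{B(\mathbf{x},r)\cap B(\mathbf{y},r)}\frac{\lambda(d\mathbf{z})}{\rho(\mathbf{z})},\qquad A_2(\mathbf{x})=1-\frac{2\bar\rho}{\Lambda}2\pi(1-\cos r)+\frac{\bar\rho^2}{\Lambda}\int_{B(\mathbf{x},r)}\frac{\lambda(d\mathbf{z})}{\rho(\mathbf{z})}.$$ Then $A_1\ge 0$ and $A_2\ge0$ everywhere, and if $r<\pi$ or $\rho$ is not $\lambda$-almost everywhere equal to $\bar\rho$, then $A_2>0$ everywhere and $C>0$. Let $\gamma$ be Euler's constant and $\mathrm{Ei}(x)=-\int_{-x}^\infty \frac{e^{-t}}{t}\,dt$ the exponential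 integral (Cauchy principal value), and for $A>0$ let $$\psi_1(A)=\frac{e^{-\Lambda}}{A^2}\big(e^{\Lambda A}-1-\mathrm{Ei}(\Lambda A)+\gamma+\log(\Lambda A)\big),\quad \psi_2(A)=\frac{e^{-\Lambda}}{A}\big(\mathrm{Ei}(\Lambda A)-\gamma-\log(\Lambda A)\big),\quad \psi_3(A)=\frac{e^{-\Lambda}}{A}\big(e^{\Lambda A}-1\big),$$ continued to $A=0$ by their limits $e^{-\Lambda}\Lambda^2/4$, $e^{-\Lambda}\Lambda$ and $e^{-\Lambda}\Lambda$. Put $$V=\frac1{\Lambda^2}\int_{\mathbb{S}^2}\int_{\mathbb{S}^2}\big(\rho(\mathbf{x})-\bar\rho\mathbf 1[\mathbf{x}\in B(\mathbf{y},r)]\big)\big(\rho(\mathbf{y})-\bar\rho\mathbf 1[\mathbf{y}\in B(\mathbf{x},r)]\big)\psi_1(A_1(\mathbf{x},\mathbf{y}))\,\lambda(d\mathbf{x})\lambda(d\mathbf{y})+\frac1\Lambda\int_{\mathbb{S}^2}\psi_2(A_2(\mathbf{x}))\rho(\mathbf{x})\,\lambda(d\mathbf{x})-\psi_3(C)^2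 .$$ Then $$\operatorname{Var}\hat H_1(r)=V,\qquad \operatorname{Var}\hat H_0(r)=V+e^{-\Lambda}(1-e^{-\Lambda})-2e^{-\Lambda}\psi_3(C).$$ -/

import Mathlib

open MeasureTheory ProbabilityTheory Filter Topology

noncomputable section

namespace SphericalPoisson

/-- The unit sphere `𝕊²` in three-dimensional Euclidean space. -/
abbrev S2 : Type := Metric.sphere (0 : EuclideanSpace ℝ (Fin 3)) 1

/-- The surface area measure on `𝕊²` (of total mass `4π`). -/
def area : Measure S2 := (volume : Measure (EuclideanSpace ℝ (Fin 3))).toSphere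

/-- The geodesic (great circle) distance, with values in `[0, π]`. -/
def geoDist (x y : S2) : ℝ :=
  InnerProductGeometry.angle (x : EuclideanSpace ℝ (Fin 3)) (y : EuclideanSpace ℝ (Fin 3))

/-- The spherical cap with centre `x` and geodesic radius `r`. -/
def cap (x : S2) (r : ℝ) : Set S2 := {y | geoDist x y ≤ r}

/-- The indicator `𝟙[x ∈ B]`. -/
def ind (B : Set S2) (x : S2) : ℝ := B.indicator (fun _ => 1) x

/-! ### Point patterns and Poisson processes

Since `𝕊²` is compact, the locally finite (simple) point patterns are the finite subsets. -/

open scoped Classical in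
/-- The restriction `x_B = x ∩ B` of a point pattern. -/
def restrictTo (B : Set S2) (x : Finset S2) : Finset S2 := x.filter (· ∈ B)

/-- The number of points of a pattern in `B`. -/
def countIn (B : Set S2) (x : Finset S2) : ℕ := (restrictTo B x).card

/-- The usual σ-algebra on point patterns: the smallest one for which all counts `countIn B`,
with `B` a Borel set, are measurable. -/
abbrev patternSigma : MeasurableSpace (Finset S2) :=
  ⨆ (B : Set S2) (_ : MeasurableSet B), MeasurableSpace.comap (countIn B) ⊤

open scoped Classical in
/-- The point pattern `{x₁, …, xₙ}`. -/
def patternOf {n : ℕ} (x : Fin n → S2) : Finset S2 := Finset.univ.image x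

/-- The intensity measure `μ(B) = ∫_B ρ dλ`. -/
def intensityMeasure (ρ : S2 → ℝ) : Measure S2 :=
  area.withDensity (fun x => ENNReal.ofReal (ρ x))

/-- `X` is a Poisson process on `𝕊²` with intensity function `ρ`: it is a point process; the number
of points in every Borel set `B` with `μ(B) < ∞` is Poisson distributed with mean `μ(B)`; and if
`0 < μ(B) < ∞`, then given that there are `n` points in `B`, the pattern `X ∩ B` is distributed
as `n` independent points of `B` with density proportional to `ρ`. -/
structure IsPoissonProcess {Ω : Type*} [MeasurableSpace Ω] (P : Measure Ω) (X : Ω → Finset S2)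
    (ρ : S2 → ℝ) : Prop where
  measurable : Measurable[_, patternSigma] X
  count : ∀ B : Set S2, MeasurableSet B → intensityMeasure ρ B ≠ ⊤ →
    P.map (fun ω => countIn B (X ω)) = poissonMeasure (intensityMeasure ρ B).toNNReal
  binomial : ∀ B : Set S2, MeasurableSet B → intensityMeasure ρ B ≠ 0 → intensityMeasure ρ B ≠ ⊤ →
    ∀ (n : ℕ) (F : Set (Finset S2)), MeasurableSet[patternSigma] F →
      cond P {ω | countIn B (X ω) = n} {ω | restrictTo B (X ω) ∈ F} =
        Measure.pi (fun _ : Fin n => cond (intensityMeasure ρ) B) {x | patternOf x ∈ F}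

/-! ### The estimators -/

/-- `ρ̄ = inf ρ`. -/
def infIntensity (ρ : S2 → ℝ) : ℝ := ⨅ x, ρ x

/-- `μ(𝕊²) = ∫ ρ dλ`. -/
def totalMass (ρ : S2 → ℝ) : ℝ := ∫ x, ρ x ∂area

open scoped Classical in
/-- The estimator of the inhomogeneous `K`-function. -/
def Khat (ρ : S2 → ℝ) (r : ℝ) (x : Finset S2) : ℝ :=
  1 / (4 * Real.pi) *
    ∑ a ∈ x, ∑ b ∈ x.erase a, (if geoDist a b ≤ r then 1 else 0) / (ρ a * ρ b)

/-- The estimator of the inhomogeneous `F`-function based on the finite grid `G`. -/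
def Fhat (ρ : S2 → ℝ) (G : Finset S2) (r : ℝ) (x : Finset S2) : ℝ :=
  1 - (∑ p ∈ G, ∏ a ∈ restrictTo (cap p r) x, (1 - infIntensity ρ / ρ a)) / (G.card : ℝ)

open scoped Classical in
/-- The estimator of the inhomogeneous `H`-function, where `e` is the value that is assigned to the
empty pattern. -/
def Hhat (e : ℝ) (ρ : S2 → ℝ) (r : ℝ) (x : Finset S2) : ℝ :=
  if x = ∅ then e
  else 1 - (∑ a ∈ x, ∏ b ∈ x.erase a, (1 - infIntensity ρ * ind (cap a r) b / ρ b)) / (x.card : ℝ)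

/-! ### The functions in the variance formulas -/

/-- The exponential integral `Ei(x) = - ∫_{-x}^∞ e^{-t} / t dt` for `x ≠ 0`, where the integral is
a Cauchy principal value at `t = 0` (which matters when `x > 0`). -/
def Ei (x : ℝ) : ℝ :=
  limUnder (𝓝[>] (0 : ℝ)) (fun ε => - ∫ t in {t : ℝ | -x < t ∧ ε < |t|}, Real.exp (-t) / t)

/-- The function `A₁`. -/
def A1 (ρ : S2 → ℝ) (r : ℝ) (x y : S2) : ℝ :=
  1 - 2 * infIntensity ρ / totalMass ρ * (2 * Real.pi * (1 - Real.cos r))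
    + infIntensity ρ ^ 2 / totalMass ρ * ∫ z in cap x r ∩ cap y r, 1 / ρ z ∂area

/-- The function `A₂`. -/
def A2 (ρ : S2 → ℝ) (r : ℝ) (x : S2) : ℝ :=
  1 - 2 * infIntensity ρ / totalMass ρ * (2 * Real.pi * (1 - Real.cos r))
    + infIntensity ρ ^ 2 / totalMass ρ * ∫ z in cap x r, 1 / ρ z ∂area

/-- The constant `C = 1 - ρ̄ 2π(1 - cos r) / μ(𝕊²)`. -/
def Cconst (ρ : S2 → ℝ) (r : ℝ) : ℝ :=
  1 - infIntensity ρ / totalMass ρ * (2 * Real.pi * (1 - Real.cos r))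

/-- `e^{-m} / A² (e^{mA} - 1 - Ei(mA) + γ + log(mA))`, continued by its limit `e^{-m} m² / 4`
at `A = 0`. -/
def psi1 (m A : ℝ) : ℝ :=
  if A = 0 then Real.exp (-m) * m ^ 2 / 4
  else Real.exp (-m) / A ^ 2 *
    (Real.exp (m * A) - 1 - Ei (m * A) + Real.eulerMascheroniConstant + Real.log (m * A))

/-- `e^{-m} / A (Ei(mA) - γ - log(mA))`, continued by its limit `e^{-m} m` at `A = 0`. -/
def psi2 (m A : ℝ) : ℝ :=
  if A = 0 then Real.exp (-m) * m
  else Real.exp (-m) / A *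
    (Ei (m * A) - Real.eulerMascheroniConstant - Real.log (m * A))

/-- `e^{-m} / A (e^{mA} - 1)`, continued by its limit `e^{-m} m` at `A = 0`. -/
def psi3 (m A : ℝ) : ℝ :=
  if A = 0 then Real.exp (-m) * m else Real.exp (-m) / A * (Real.exp (m * A) - 1)

/-- The integrand of the double integral in the variance of the estimator of `H`. -/
def integrandH1 (ρ : S2 → ℝ) (r : ℝ) (x y : S2) : ℝ :=
  (ρ x - infIntensity ρ * ind (cap y r) x) * (ρ y - infIntensity ρ * ind (cap x r) y) *
    psi1 (totalMass ρ) (A1 ρ r x y)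

/-- The integrand of the single integral in the variance of the estimator of `H`. -/
def integrandH2 (ρ : S2 → ℝ) (r : ℝ) (x : S2) : ℝ :=
  psi2 (totalMass ρ) (A2 ρ r x) * ρ x

/-- The closed form for the variance of the estimator of `H`. -/
def varH (ρ : S2 → ℝ) (r : ℝ) : ℝ :=
  1 / totalMass ρ ^ 2 * (∫ y, ∫ x, integrandH1 ρ r x y ∂area ∂area)
    + 1 / totalMass ρ * (∫ x, integrandH2 ρ r x ∂area)
    - psi3 (totalMass ρ) (Cconst ρ r) ^ 2

end SphericalPoisson

end

/-!
The intensity `ρ` is bounded below by `ρ̄ > 0` and integrable, so the process has finitely many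
points: their number is Poisson distributed with mean `Λ = μ(𝕊²)`, and given the number they are
independent with the law `ν = μ / Λ` (`IsPoissonProcess.map_eq`). Everything is computed from two
consequences: the Mecke formula (`IsPoissonProcess.mecke`)
`E ∑_{a ∈ X} φ(a, X \ {a}) = ∫ E φ(a, X) μ(da)`, and
`E [g(|X|) ∏_{b ∈ X} h(b)] = ∑ₙ e^{-Λ} Λⁿ/n! g(n) (∫ h dν)ⁿ`
(`IsPoissonProcess.lintegral_card_mul_prod`). They need a supply of measurable functions of point
patterns; `measurable_of_patternOf` reduces measurability to functions of `n` points, since the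
points of a pattern can be enumerated measurably by sorting them after an embedding in the real
line. All moments are computed as lower Lebesgue integrals of nonnegative functions; that they are
finite yields square integrability (`variance_toReal`).

* The estimator of `K` is a sum over ordered pairs of distinct points. Its square is a sum over
  two pairs that are disjoint, share a point, or coincide (`IsPoissonProcess.lintegral_pairSum_sq`).
  The first case gives the square of the mean and the other two give the variance, by Archimedes'
  formula `2π(1 - cos r)` for the area of a cap (`area_cap`), which is derived from the volume of a
  sector of the ball.

* Put `h_a(b) = 1 - ρ̄ 𝟙[b ∈ B(a, r)] / ρ(b) ∈ [0, 1]` (`capFactor`). Then `∫ h_a dν = C`,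
  `∫ h_a h_c dν = A₁(a, c)` and `A₂(a) = A₁(a, a)`, which shows at once that these quantities are
  nonnegative. The estimator of `F` is `1` minus the mean over the grid of `∏_{b ∈ X} h_p(b)`, and
  the probability generating functional `e^{-Λ + Λ ∫ h dν}` gives its variance.

* The estimator of `H` is `1 - Y - (1 - e) 𝟙[X = ∅]`, where `Y` is the mean over `a ∈ X` of
  `∏_{b ∈ X \ {a}} h_a(b)`, and `0` for the empty pattern. In `Y²` the diagonal is treated by one
  application of the Mecke formula and the remaining pairs by two. The added points give the
  weights `1/(n+1)²` and `1/(n+2)²`, and the pairs also the factor `h_a(c) h_c(a)`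
  (`IsPoissonProcess.lintegral_averageProd_sq`). The series that arise are `ψ₁`, `ψ₂`, `ψ₃`,
  up to powers of `Λ` (`hasSum_psi1`, `hasSum_psi2`, `hasSum_psi3`), by the power series
  `Ei(x) - γ - log x = ∑_{n ≥ 1} xⁿ / (n · n!)`. The latter rests on
  `∫₀^∞ e^{-t} log t dt = Γ'(1) = -γ`. Finally `Y` vanishes on the event `X = ∅`, so that the
  value `e` only adds the variance of the indicator and a covariance.
-/

noncomputable section

namespace SphericalPoisson

open scoped ENNReal

attribute [local instance] patternSigma

/-! ### Measurable functions of a point pattern -/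

lemma nonempty_S2 : Nonempty S2 :=
  (NormedSpace.sphere_nonempty.2 zero_le_one).to_subtype

lemma mem_patternOf {n : ℕ} {y : Fin n → S2} {a : S2} : a ∈ patternOf y ↔ ∃ i, y i = a := by
  classical
  simp [patternOf]

lemma patternOf_eq_map {n : ℕ} {y : Fin n → S2} (hy : Function.Injective y) :
    patternOf y = Finset.univ.map ⟨y, hy⟩ := by
  ext a
  simp [mem_patternOf]

lemma card_patternOf {n : ℕ} {y : Fin n → S2} (hy : Function.Injective y) :
    (patternOf y).card = n := by
  simp [patternOf_eq_map hy]

lemma measurable_countIn {B : Set S2} (hB : MeasurableSet B) : Measurable (countIn B) := by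
  intro s hs
  exact (le_iSup₂_of_le (f := fun (B : Set S2) (_ : MeasurableSet B) =>
    MeasurableSpace.comap (countIn B) ⊤) B hB le_rfl) _ ⟨s, trivial, rfl⟩

lemma countIn_univ (x : Finset S2) : countIn Set.univ x = x.card := by
  simp [countIn, restrictTo]

lemma restrictTo_univ (x : Finset S2) : restrictTo Set.univ x = x := by
  simp [restrictTo]

lemma measurable_card : Measurable (fun x : Finset S2 => x.card) := by
  have := measurable_countIn MeasurableSet.univ
  simpa only [funext countIn_univ] using this

lemma measurable_of_countIn {α : Type*} [MeasurableSpace α] {f : α → Finset S2}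
    (h : ∀ B, MeasurableSet B → Measurable fun a => countIn B (f a)) : Measurable f := by
  rw [measurable_iff_le_map]
  refine iSup₂_le fun B hB => ?_
  rintro _ ⟨s, -, rfl⟩
  exact h B hB trivial

/-- The points of a pattern with `n` elements can be enumerated measurably: embed `𝕊²` into the
real line and sort. -/
lemma exists_measurable_enumeration (n : ℕ) :
    ∃ s : Finset S2 → Fin n → S2, Measurable s ∧
      ∀ x : Finset S2, x.card = n → Function.Injective (s x) ∧ patternOf (s x) = x := by
  classical
  obtain ⟨e, he⟩ := exists_measurableEmbedding_real S2
  let : LinearOrder S2 := LinearOrder.lift' e he.injective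
  have hle : ∀ a b : S2, a ≤ b ↔ e a ≤ e b := fun a b => Iff.rfl
  obtain ⟨o⟩ := nonempty_S2
  refine ⟨fun x => if h : x.card = n then x.orderEmbOfFin h else fun _ => o, ?_, ?_⟩
  · rw [measurable_pi_iff]
    intro i
    rw [← he.measurable_comp_iff]
    refine measurable_of_Iic fun t => ?_
    -- The `i`-th smallest point is at most `t` iff at least `i + 1` points are, and the number of
    -- such points is a measurable function of the pattern.
    have key : ∀ x : Finset S2, ∀ h : x.card = n,
        e (x.orderEmbOfFin h i) ≤ t ↔ (i : ℕ) + 1 ≤ countIn (e ⁻¹' Set.Iic t) x := by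
      intro x h
      have hc : countIn (e ⁻¹' Set.Iic t) x
          = (Finset.univ.filter fun j : Fin n => e (x.orderEmbOfFin h j) ≤ t).card := by
        have hx : x = Finset.univ.map (x.orderEmbOfFin h).toEmbedding := by
          ext a
          rw [← Finset.mem_coe, ← Finset.range_orderEmbOfFin x h]
          simp
        rw [countIn, restrictTo]
        conv_lhs => rw [hx, Finset.filter_map, Finset.card_map]
        congr 1
      rw [hc]
      constructor
      · intro hi
        rw [← Fin.card_Iic]
        refine Finset.card_le_card fun j hj => ?_
        rw [Finset.mem_Iic] at hj
        simp only [Finset.mem_filter, Finset.mem_univ, true_and]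
        exact ((hle _ _).1 ((x.orderEmbOfFin h).monotone hj)).trans hi
      · intro hi
        by_contra hcon
        have : (Finset.univ.filter fun j : Fin n => e (x.orderEmbOfFin h j) ≤ t)
            ⊆ Finset.Iio i := by
          intro j hj
          simp only [Finset.mem_filter, Finset.mem_univ, true_and] at hj
          rw [Finset.mem_Iio]
          by_contra hij
          exact hcon (((hle _ _).1 ((x.orderEmbOfFin h).monotone (not_lt.1 hij))).trans hj)
        have := Finset.card_le_card this
        rw [Fin.card_Iio] at this
        omega
    have hset : (e ∘ fun x : Finset S2 =>
          (if h : x.card = n then (x.orderEmbOfFin h : Fin n → S2) else fun _ => o) i) ⁻¹' Set.Iic t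
        = ({x | x.card = n} ∩ {x | (i : ℕ) + 1 ≤ countIn (e ⁻¹' Set.Iic t) x}) ∪
          ({x | x.card = n}ᶜ ∩ {_x | e o ≤ t}) := by
      ext x
      by_cases h : x.card = n
      · simp [h, key x h]
      · simp [h]
    rw [hset]
    have h1 : MeasurableSet {x : Finset S2 | x.card = n} :=
      measurable_card (measurableSet_singleton n)
    have h2 : MeasurableSet {x | (i : ℕ) + 1 ≤ countIn (e ⁻¹' Set.Iic t) x} :=
      measurable_countIn (he.measurable measurableSet_Iic) measurableSet_Ici
    exact (h1.inter h2).union (h1.compl.inter (MeasurableSet.const _))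
  · intro x h
    simp only [h, dite_true]
    refine ⟨(x.orderEmbOfFin h).injective, ?_⟩
    ext a
    rw [mem_patternOf, ← Finset.mem_coe, ← Finset.range_orderEmbOfFin x h]
    rfl

/-- A function of a parameter and a point pattern is measurable as soon as, for every `n`, it is a
measurable function of the parameter and the points of `n`-point patterns. -/
lemma measurable_of_patternOf {T β : Type*} [MeasurableSpace T] [MeasurableSpace β]
    {f : T × Finset S2 → β} (F : ∀ n, T × (Fin n → S2) → β) (hF : ∀ n, Measurable (F n))
    (hfF : ∀ n t (y : Fin n → S2), Function.Injective y → f (t, patternOf y) = F n (t, y)) :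
    Measurable f := by
  choose s hs hs' using exists_measurable_enumeration
  intro A hA
  have hset : f ⁻¹' A = ⋃ n, {z : T × Finset S2 | z.2.card = n} ∩
      (fun z : T × Finset S2 => F n (z.1, s n z.2)) ⁻¹' A := by
    ext ⟨t, x⟩
    simp only [Set.mem_preimage, Set.mem_iUnion, Set.mem_inter_iff, Set.mem_ofPred_eq,
      exists_eq_left']
    have h := hs' _ x rfl
    rw [← hfF _ _ _ h.1, h.2]
  rw [hset]
  refine MeasurableSet.iUnion fun n => MeasurableSet.inter ?_ ?_
  · exact (measurable_card.comp measurable_snd) (measurableSet_singleton n)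
  · exact ((hF n).comp (measurable_fst.prodMk ((hs n).comp measurable_snd))) hA

open scoped Classical in
lemma patternOf_cons {n : ℕ} (a : S2) (y : Fin n → S2) :
    patternOf (Fin.cons a y : Fin (n + 1) → S2) = insert a (patternOf y) := by
  ext b
  simp [mem_patternOf, Fin.exists_fin_succ, eq_comm]

open scoped Classical in
lemma countIn_insert (B : Set S2) (a : S2) (x : Finset S2) :
    countIn B (insert a x) = countIn B x + if a ∈ B ∧ a ∉ x then 1 else 0 := by
  unfold countIn restrictTo
  rw [Finset.filter_insert]
  by_cases hB : a ∈ B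
  · by_cases hx : a ∈ x
    · simp [hB, hx]
    · simp [hB, hx]
  · simp [hB]

lemma measurable_patternOf (n : ℕ) : Measurable (patternOf : (Fin n → S2) → Finset S2) := by
  classical
  refine measurable_of_countIn fun B hB => ?_
  induction n with
  | zero =>
    have : (fun y : Fin 0 → S2 => countIn B (patternOf y)) = fun _ => countIn B ∅ := by
      funext y; congr 1
    rw [this]; exact measurable_const
  | succ n ih =>
    have : (fun y : Fin (n + 1) → S2 => countIn B (patternOf y)) = fun y : Fin (n + 1) → S2 =>
        countIn B (patternOf (Fin.tail y)) +
          if y 0 ∈ B ∧ ¬ ∃ i, Fin.tail y i = y 0 then 1 else 0 := by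
      funext y
      conv_lhs => rw [← Fin.cons_self_tail y, patternOf_cons, countIn_insert]
      simp only [mem_patternOf]
    rw [this]
    have ht : Measurable (Fin.tail : (Fin (n + 1) → S2) → Fin n → S2) :=
      measurable_pi_iff.2 fun i => measurable_pi_apply _
    refine (ih.comp ht).add (Measurable.ite ?_ measurable_const measurable_const)
    refine MeasurableSet.inter (measurable_pi_apply (0 : Fin (n + 1)) hB) (MeasurableSet.compl ?_)
    have : {y : Fin (n + 1) → S2 | ∃ i, Fin.tail y i = y 0} =
        ⋃ i : Fin n, {y | y i.succ = y 0} := by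
      ext y; simp [Fin.tail]
    change MeasurableSet {y : Fin (n + 1) → S2 | ∃ i, Fin.tail y i = y 0}
    rw [this]
    exact MeasurableSet.iUnion fun i =>
      measurableSet_eq_fun (measurable_pi_apply _) (measurable_pi_apply _)

section Sums

variable {T : Type*} [MeasurableSpace T]

lemma prod_patternOf {β : Type*} [CommMonoid β] {n : ℕ} {y : Fin n → S2}
    (hy : Function.Injective y) (h : S2 → β) : ∏ b ∈ patternOf y, h b = ∏ i, h (y i) := by
  simp [patternOf_eq_map hy]

lemma sum_patternOf {β : Type*} [AddCommMonoid β] {n : ℕ} {y : Fin n → S2}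
    (hy : Function.Injective y) (h : S2 → β) : ∑ b ∈ patternOf y, h b = ∑ i, h (y i) := by
  simp [patternOf_eq_map hy]

lemma measurable_prod_pattern {h : T → S2 → ℝ≥0∞} (hh : Measurable (Function.uncurry h)) :
    Measurable fun z : T × Finset S2 => ∏ b ∈ z.2, h z.1 b := by
  refine measurable_of_patternOf (fun n z => ∏ i, h z.1 (z.2 i)) (fun n => ?_)
    fun n t y hy => prod_patternOf hy _
  refine Finset.measurable_prod _ fun i _ => ?_
  exact hh.comp (measurable_fst.prodMk ((measurable_pi_apply i).comp measurable_snd))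

open scoped Classical in
lemma patternOf_erase {n : ℕ} {y : Fin (n + 1) → S2} (hy : Function.Injective y)
    (i : Fin (n + 1)) :
    (patternOf y).erase (y i) = patternOf (i.removeNth y) := by
  ext b
  simp only [Finset.mem_erase, mem_patternOf, Fin.removeNth]
  constructor
  · rintro ⟨hb, j, rfl⟩
    obtain ⟨k, hk⟩ := Fin.exists_succAbove_eq (x := j) (y := i) (fun h => hb (by rw [h]))
    exact ⟨k, by rw [hk]⟩
  · rintro ⟨k, rfl⟩
    exact ⟨fun h => Fin.succAbove_ne i k (hy h), _, rfl⟩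

open scoped Classical in
lemma measurable_sum_erase_pattern {φ : T → S2 → Finset S2 → ℝ≥0∞}
    (hφ : Measurable fun z : T × S2 × Finset S2 => φ z.1 z.2.1 z.2.2) :
    Measurable fun z : T × Finset S2 => ∑ b ∈ z.2, φ z.1 b (z.2.erase b) := by
  refine measurable_of_patternOf (fun n => match n with
    | 0 => fun _ => 0
    | n + 1 => fun z => ∑ i, φ z.1 (z.2 i) (patternOf (i.removeNth z.2))) (fun n => ?_)
    fun n t y hy => ?_
  · cases n with
    | zero => exact measurable_const
    | succ n =>
      refine Finset.measurable_sum _ fun i _ => ?_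
      have h1 : Measurable fun z : T × (Fin (n + 1) → S2) => i.removeNth z.2 :=
        measurable_pi_iff.2 fun j => (measurable_pi_apply _).comp measurable_snd
      exact hφ.comp (measurable_fst.prodMk (((measurable_pi_apply i).comp measurable_snd).prodMk
        ((measurable_patternOf n).comp h1)))
  · cases n with
    | zero => simp [patternOf]
    | succ n =>
      simp only
      rw [sum_patternOf hy]
      exact Finset.sum_congr rfl fun i _ => by rw [patternOf_erase hy]

lemma measurable_prod_pattern' {h : S2 → ℝ≥0∞} (hh : Measurable h) :
    Measurable fun x : Finset S2 => ∏ b ∈ x, h b := by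
  have := measurable_prod_pattern (T := Unit) (h := fun _ => h) (hh.comp measurable_snd)
  exact this.comp (measurable_const.prodMk measurable_id : Measurable fun x => ((), x))

open scoped Classical in
lemma measurable_sum_erase_pattern' {φ : S2 → Finset S2 → ℝ≥0∞}
    (hφ : Measurable (Function.uncurry φ)) :
    Measurable fun x : Finset S2 => ∑ b ∈ x, φ b (x.erase b) := by
  have := measurable_sum_erase_pattern (T := Unit) (φ := fun _ => φ) (hφ.comp measurable_snd)
  exact this.comp (measurable_const.prodMk measurable_id : Measurable fun x => ((), x))

end Sums

/-! ### The law of a Poisson process and the Mecke formula -/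

/-- The weight `e^{-m} mⁿ / n!` of `n` under the Poisson distribution with mean `m = μ(𝕊²)`. -/
def poissonWeight (ρ : S2 → ℝ) (n : ℕ) : ℝ≥0∞ :=
  poissonMeasure (intensityMeasure ρ Set.univ).toNNReal {n}

/-- The distribution of one point of the process, i.e. the normalized intensity measure. -/
def pointLaw (ρ : S2 → ℝ) : Measure S2 := cond (intensityMeasure ρ) Set.univ

lemma poissonWeight_succ_mul (ρ : S2 → ℝ) (ht : intensityMeasure ρ Set.univ ≠ ⊤) (n : ℕ) :
    poissonWeight ρ (n + 1) * (n + 1 : ℕ) = poissonWeight ρ n * intensityMeasure ρ Set.univ := by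
  unfold poissonWeight
  rw [poissonMeasure_singleton, poissonMeasure_singleton]
  lift intensityMeasure ρ Set.univ to NNReal using ht with m
  rw [ENNReal.toNNReal_coe, ← ENNReal.ofReal_coe_nnreal, ← ENNReal.ofReal_natCast,
    ← ENNReal.ofReal_mul (by positivity), ← ENNReal.ofReal_mul (by positivity)]
  congr 1
  rw [Nat.factorial_succ]
  push_cast
  field_simp
  ring

section Law

variable {Ω : Type*} [MeasurableSpace Ω] {P : Measure Ω} [IsProbabilityMeasure P]
  {X : Ω → Finset S2} {ρ : S2 → ℝ}

lemma isProbabilityMeasure_pointLaw (h0 : intensityMeasure ρ Set.univ ≠ 0)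
    (ht : intensityMeasure ρ Set.univ ≠ ⊤) : IsProbabilityMeasure (pointLaw ρ) :=
  cond_isProbabilityMeasure_of_finite h0 ht

lemma smul_pointLaw (h0 : intensityMeasure ρ Set.univ ≠ 0)
    (ht : intensityMeasure ρ Set.univ ≠ ⊤) :
    intensityMeasure ρ Set.univ • pointLaw ρ = intensityMeasure ρ := by
  rw [pointLaw, ProbabilityTheory.cond, Measure.restrict_univ, smul_smul,
    ENNReal.mul_inv_cancel h0 ht, one_smul]

/-- The law of a Poisson process: a Poisson distributed number of independent points. -/
lemma IsPoissonProcess.map_eq (hX : IsPoissonProcess P X ρ)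
    (h0 : intensityMeasure ρ Set.univ ≠ 0) (ht : intensityMeasure ρ Set.univ ≠ ⊤) :
    P.map X = Measure.sum fun n => poissonWeight ρ n •
      (Measure.pi fun _ : Fin n => pointLaw ρ).map patternOf := by
  have hXm : Measurable X := hX.measurable
  have hcm : Measurable fun ω => countIn Set.univ (X ω) :=
    (measurable_countIn MeasurableSet.univ).comp hXm
  ext F hF
  rw [Measure.map_apply hXm hF, Measure.sum_apply _ hF]
  have hsplit : X ⁻¹' F = ⋃ n, {ω | countIn Set.univ (X ω) = n} ∩ X ⁻¹' F := by
    ext ω; simp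
  have hm : ∀ n, MeasurableSet {ω | countIn Set.univ (X ω) = n} :=
    fun n => hcm (measurableSet_singleton n)
  rw [hsplit, measure_iUnion]
  · refine tsum_congr fun n => ?_
    rw [Measure.smul_apply, smul_eq_mul, Measure.map_apply (measurable_patternOf n) hF]
    have h1 := hX.binomial Set.univ MeasurableSet.univ h0 ht n F hF
    simp only [restrictTo_univ] at h1
    rw [← cond_mul_eq_inter (hm n)]
    have h2 : P {ω | countIn Set.univ (X ω) = n} = poissonWeight ρ n := by
      rw [poissonWeight, ← hX.count Set.univ MeasurableSet.univ ht,
        Measure.map_apply hcm (measurableSet_singleton n)]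
      rfl
    rw [h2, mul_comm]
    congr 1
  · intro i j hij
    refine Set.disjoint_left.2 fun ω h1 h2 => hij ?_
    exact h1.1.symm.trans h2.1
  · exact fun n => (hm n).inter (hXm hF)

lemma IsPoissonProcess.lintegral_eq (hX : IsPoissonProcess P X ρ)
    (h0 : intensityMeasure ρ Set.univ ≠ 0) (ht : intensityMeasure ρ Set.univ ≠ ⊤)
    {f : Finset S2 → ℝ≥0∞} (hf : Measurable f) :
    ∫⁻ ω, f (X ω) ∂P = ∑' n, poissonWeight ρ n *
      ∫⁻ y, f (patternOf y) ∂(Measure.pi fun _ : Fin n => pointLaw ρ) := by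
  rw [← lintegral_map hf hX.measurable, hX.map_eq h0 ht, lintegral_sum_measure]
  refine tsum_congr fun n => ?_
  rw [lintegral_smul_measure, lintegral_map hf (measurable_patternOf n), smul_eq_mul]

lemma lintegral_removeNth {ν : Measure S2} [IsProbabilityMeasure ν] {n : ℕ} (i : Fin (n + 1))
    {f : S2 → (Fin n → S2) → ℝ≥0∞} (hf : Measurable (Function.uncurry f)) :
    ∫⁻ y, f (y i) (i.removeNth y) ∂(Measure.pi fun _ : Fin (n + 1) => ν) =
      ∫⁻ a, ∫⁻ y, f a y ∂(Measure.pi fun _ : Fin n => ν) ∂ν := by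
  refine Eq.trans ?_ (lintegral_prod (Function.uncurry f) hf.aemeasurable)
  exact (measurePreserving_piFinSuccAbove (fun _ : Fin (n + 1) => ν) i).lintegral_comp hf

lemma lintegral_prod_pi {ν : Measure S2} [IsProbabilityMeasure ν] {h : S2 → ℝ≥0∞}
    (hh : Measurable h) (n : ℕ) :
    ∫⁻ y, ∏ i, h (y i) ∂(Measure.pi fun _ : Fin n => ν) = (∫⁻ a, h a ∂ν) ^ n := by
  induction n with
  | zero => simp
  | succ n ih =>
    have h1 : Measurable fun y : Fin n → S2 => ∏ i, h (y i) :=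
      Finset.measurable_prod _ fun i _ => hh.comp (measurable_pi_apply i)
    have := lintegral_removeNth (ν := ν) (n := n) 0 (f := fun a y => h a * ∏ i, h (y i))
      ((hh.comp measurable_fst).mul (h1.comp measurable_snd))
    simp only [Fin.prod_univ_succ]
    refine Eq.trans this ?_
    simp_rw [lintegral_const_mul _ h1, ih]
    rw [lintegral_mul_const _ hh, pow_succ']

/-- The points of an independent sample from a diffuse distribution are almost surely distinct. -/
lemma ae_injective_pi {ν : Measure S2} [IsProbabilityMeasure ν] [NullSingletonClass ν] (n : ℕ) :
    ∀ᵐ y ∂(Measure.pi fun _ : Fin n => ν), Function.Injective y := by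
  cases n with
  | zero => exact Eventually.of_forall fun y => Function.injective_of_subsingleton y
  | succ n =>
  have key : ∀ (i : Fin (n + 1)) (k : Fin n),
      ∀ᵐ y ∂(Measure.pi fun _ : Fin (n + 1) => ν), y i ≠ y (i.succAbove k) := by
    intro i k
    have hs : MeasurableSet {z : S2 × (Fin n → S2) | z.1 = z.2 k} :=
      measurableSet_eq_fun measurable_fst ((measurable_pi_apply k).comp measurable_snd)
    have h0 : (ν.prod (Measure.pi fun _ : Fin n => ν)) {z | z.1 = z.2 k} = 0 := by
      rw [Measure.prod_apply_symm hs]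
      refine lintegral_eq_zero_of_ae_eq_zero (Eventually.of_forall fun y => ?_)
      exact measure_singleton (y k)
    have := (measurePreserving_piFinSuccAbove (fun _ : Fin (n + 1) => ν) i).measure_preimage
      hs.nullMeasurableSet
    rw [h0] at this
    rw [ae_iff]
    simpa [Fin.removeNth] using this
  have := ae_all_iff.2 fun i => ae_all_iff.2 (key i)
  filter_upwards [this] with y hy i j hij
  by_contra hne
  obtain ⟨k, hk⟩ := Fin.exists_succAbove_eq (x := j) (y := i) (Ne.symm hne)
  exact hy i k (by rw [hk, hij])

lemma nullSingletonClass_pointLaw [NullSingletonClass area] : NullSingletonClass (pointLaw ρ) where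
  measure_singleton a := by
    refine (cond_absolutelyContinuous (μ := intensityMeasure ρ) (s := Set.univ)) ?_
    exact withDensity_absolutelyContinuous _ _ (measure_singleton a)

open scoped Classical in
/-- The Mecke formula: summing over the points of a Poisson process amounts to integrating with
respect to the intensity measure over an independent additional point. -/
lemma IsPoissonProcess.mecke [NullSingletonClass area] (hX : IsPoissonProcess P X ρ)
    (h0 : intensityMeasure ρ Set.univ ≠ 0) (ht : intensityMeasure ρ Set.univ ≠ ⊤)
    {φ : S2 → Finset S2 → ℝ≥0∞} (hφ : Measurable (Function.uncurry φ)) :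
    ∫⁻ ω, ∑ a ∈ X ω, φ a ((X ω).erase a) ∂P =
      ∫⁻ a, ∫⁻ ω, φ a (X ω) ∂P ∂(intensityMeasure ρ) := by
  have := isProbabilityMeasure_pointLaw h0 ht
  have := nullSingletonClass_pointLaw (ρ := ρ)
  have hm : Measurable fun x : Finset S2 => ∑ a ∈ x, φ a (x.erase a) :=
    measurable_sum_erase_pattern' hφ
  have hφp : ∀ n, Measurable (Function.uncurry fun (a : S2) (y : Fin n → S2) =>
      φ a (patternOf y)) := fun n =>
    hφ.comp (measurable_fst.prodMk ((measurable_patternOf n).comp measurable_snd))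
  rw [hX.lintegral_eq h0 ht (f := fun x => ∑ a ∈ x, φ a (x.erase a)) hm,
    tsum_eq_zero_add' ENNReal.summable]
  have hzero : ∀ y : Fin 0 → S2, patternOf y = ∅ := fun y => by simp [patternOf]
  simp only [hzero, Finset.sum_empty, lintegral_zero, mul_zero, zero_add]
  have hL : ∀ n : ℕ, ∫⁻ y, ∑ a ∈ patternOf y, φ a ((patternOf y).erase a)
      ∂(Measure.pi fun _ : Fin (n + 1) => pointLaw ρ) = (n + 1 : ℕ) *
        ∫⁻ a, ∫⁻ y, φ a (patternOf y) ∂(Measure.pi fun _ : Fin n => pointLaw ρ) ∂(pointLaw ρ) := by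
    intro n
    have h1 : ∫⁻ y, ∑ a ∈ patternOf y, φ a ((patternOf y).erase a)
        ∂(Measure.pi fun _ : Fin (n + 1) => pointLaw ρ) =
        ∫⁻ y, ∑ i, φ (y i) (patternOf (i.removeNth y))
          ∂(Measure.pi fun _ : Fin (n + 1) => pointLaw ρ) := by
      refine lintegral_congr_ae ?_
      filter_upwards [ae_injective_pi (ν := pointLaw ρ) (n + 1)] with y hy
      rw [sum_patternOf hy]
      exact Finset.sum_congr rfl fun i _ => by rw [patternOf_erase hy]
    rw [h1, lintegral_finsetSum]
    · rw [Finset.sum_congr rfl fun i _ => lintegral_removeNth i (hφp n)]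
      simp
    · intro i _
      have h2 : Measurable fun y : Fin (n + 1) → S2 => i.removeNth y :=
        measurable_pi_iff.2 fun j => measurable_pi_apply _
      exact (hφp n).comp ((measurable_pi_apply i).prodMk h2)
  have hR : ∀ a, ∫⁻ ω, φ a (X ω) ∂P = ∑' n, poissonWeight ρ n *
      ∫⁻ y, φ a (patternOf y) ∂(Measure.pi fun _ : Fin n => pointLaw ρ) := fun a =>
    hX.lintegral_eq h0 ht (hφ.comp (measurable_const.prodMk measurable_id))
  simp_rw [hR]
  have hmi : ∀ n, Measurable fun a => ∫⁻ y, φ a (patternOf y)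
      ∂(Measure.pi fun _ : Fin n => pointLaw ρ) := fun n => (hφp n).lintegral_prod_right'
  rw [lintegral_tsum fun n => ((hmi n).const_mul _).aemeasurable]
  refine tsum_congr fun n => ?_
  rw [hL, lintegral_const_mul _ (hmi n), ← mul_assoc, poissonWeight_succ_mul ρ ht, mul_assoc]
  conv_rhs => rw [← smul_pointLaw h0 ht]
  rw [lintegral_smul_measure, smul_eq_mul]

lemma IsPoissonProcess.lintegral_card_mul_prod [NullSingletonClass area]
    (hX : IsPoissonProcess P X ρ)
    (h0 : intensityMeasure ρ Set.univ ≠ 0) (ht : intensityMeasure ρ Set.univ ≠ ⊤)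
    (g : ℕ → ℝ≥0∞) {h : S2 → ℝ≥0∞} (hh : Measurable h) :
    ∫⁻ ω, g (X ω).card * ∏ b ∈ X ω, h b ∂P =
      ∑' n, poissonWeight ρ n * (g n * (∫⁻ a, h a ∂(pointLaw ρ)) ^ n) := by
  have := isProbabilityMeasure_pointLaw h0 ht
  have := nullSingletonClass_pointLaw (ρ := ρ)
  have hm : Measurable fun x : Finset S2 => g x.card * ∏ b ∈ x, h b :=
    ((measurable_of_countable g).comp measurable_card).mul (measurable_prod_pattern' hh)
  rw [hX.lintegral_eq h0 ht hm]
  refine tsum_congr fun n => ?_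
  congr 1
  rw [← lintegral_prod_pi hh, ← lintegral_const_mul]
  · refine lintegral_congr_ae ?_
    filter_upwards [ae_injective_pi (ν := pointLaw ρ) n] with y hy
    rw [card_patternOf hy, prod_patternOf hy]
  · exact Finset.measurable_prod _ fun i _ => hh.comp (measurable_pi_apply i)

end Law

/-! ### The area of a spherical cap -/

instance : IsFiniteMeasure area :=
  inferInstanceAs (IsFiniteMeasure (volume : Measure (EuclideanSpace ℝ (Fin 3))).toSphere)

lemma inner_eq_cos_geoDist (x y : S2) :
    inner ℝ (x : EuclideanSpace ℝ (Fin 3)) (y : EuclideanSpace ℝ (Fin 3)) =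
      Real.cos (geoDist x y) := by
  rw [geoDist, InnerProductGeometry.cos_angle]
  simp

lemma geoDist_comm (x y : S2) : geoDist x y = geoDist y x := InnerProductGeometry.angle_comm _ _

lemma mem_cap_iff {x y : S2} {r : ℝ} (hr : r ∈ Set.Icc 0 Real.pi) :
    y ∈ cap x r ↔
      Real.cos r ≤ inner ℝ (x : EuclideanSpace ℝ (Fin 3)) (y : EuclideanSpace ℝ (Fin 3)) := by
  have h : geoDist x y ∈ Set.Icc 0 Real.pi :=
    ⟨InnerProductGeometry.angle_nonneg _ _, InnerProductGeometry.angle_le_pi _ _⟩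
  rw [inner_eq_cos_geoDist, Real.strictAntiOn_cos.le_iff_ge hr h]
  rfl

lemma measurable_geoDist : Measurable (Function.uncurry geoDist) := by
  have h : Continuous fun z : S2 × S2 =>
      Real.arccos (inner ℝ (z.1 : EuclideanSpace ℝ (Fin 3)) (z.2 : EuclideanSpace ℝ (Fin 3))) :=
    Real.continuous_arccos.comp (by fun_prop)
  convert h.measurable using 2 with z
  rw [Function.uncurry, geoDist, InnerProductGeometry.angle]
  simp

/-- The volume of a horizontal slice of the sector `{v | ‖v‖ < 1, c ‖v‖ ≤ v₀}` of the unit ball: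
the slice is a disc. -/
lemma volume_slice {c : ℝ} (hc : c ∈ Set.Icc (0 : ℝ) 1) (z : ℝ) :
    volume {w : EuclideanSpace ℝ (Fin 2) | z ^ 2 + ‖w‖ ^ 2 < 1 ∧ c * √(z ^ 2 + ‖w‖ ^ 2) ≤ z} =
      (Set.Ico 0 c).indicator (fun z => ENNReal.ofReal (Real.pi * (z ^ 2 / c ^ 2 - z ^ 2))) z +
      (Set.Icc c 1).indicator (fun z => ENNReal.ofReal (Real.pi * (1 - z ^ 2))) z := by
  rcases lt_or_ge z 0 with hz | hz
  · have : {w : EuclideanSpace ℝ (Fin 2) |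
        z ^ 2 + ‖w‖ ^ 2 < 1 ∧ c * √(z ^ 2 + ‖w‖ ^ 2) ≤ z} = ∅ := by
      ext w
      simp only [Set.mem_ofPred_eq, Set.mem_empty_iff_false, iff_false, not_and, not_le]
      intro _
      exact hz.trans_le (mul_nonneg hc.1 (Real.sqrt_nonneg _))
    rw [this, Set.indicator_of_notMem (by simp [hz]),
      Set.indicator_of_notMem (by simp; intro h; linarith [hc.1])]
    simp
  have hcone : ∀ w : EuclideanSpace ℝ (Fin 2), c * √(z ^ 2 + ‖w‖ ^ 2) ≤ z ↔
      c ^ 2 * (z ^ 2 + ‖w‖ ^ 2) ≤ z ^ 2 := by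
    intro w
    rw [← sq_le_sq₀ (mul_nonneg hc.1 (Real.sqrt_nonneg _)) hz, mul_pow,
      Real.sq_sqrt (by positivity)]
  simp_rw [hcone]
  rcases lt_or_ge z c with hzc | hzc
  · have hc0 : 0 < c := hz.trans_lt hzc
    have hR : 0 ≤ z ^ 2 / c ^ 2 - z ^ 2 := by
      rw [sub_nonneg, le_div_iff₀ (by positivity)]
      nlinarith [sq_nonneg z, pow_le_one₀ hc.1 hc.2 (n := 2)]
    have : {w : EuclideanSpace ℝ (Fin 2) | z ^ 2 + ‖w‖ ^ 2 < 1 ∧ c ^ 2 * (z ^ 2 + ‖w‖ ^ 2) ≤ z ^ 2}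
        = Metric.closedBall 0 (√(z ^ 2 / c ^ 2 - z ^ 2)) := by
      ext w
      simp only [Set.mem_ofPred_eq, mem_closedBall_zero_iff]
      rw [Real.le_sqrt (norm_nonneg _) hR, le_sub_iff_add_le', le_div_iff₀ (by positivity),
        mul_comm (c ^ 2)]
      refine ⟨fun h => h.2, fun h => ⟨?_, h⟩⟩
      have : z ^ 2 < c ^ 2 := by gcongr
      by_contra hcon
      nlinarith [sq_nonneg c, mul_le_mul_of_nonneg_right (not_lt.1 hcon) (sq_nonneg c)]
    rw [this, Set.indicator_of_mem (Set.mem_Ico.2 ⟨hz, hzc⟩),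
      Set.indicator_of_notMem (by simp [hzc]), add_zero,
      EuclideanSpace.volume_closedBall_fin_two, ← ENNReal.ofReal_pow (Real.sqrt_nonneg _),
      Real.sq_sqrt hR, mul_comm, ENNReal.ofReal_mul Real.pi_nonneg]
  · rw [Set.indicator_of_notMem (by simp; intro _; exact hzc), zero_add]
    rcases lt_or_ge 1 z with hz1 | hz1
    · have : {w : EuclideanSpace ℝ (Fin 2) |
          z ^ 2 + ‖w‖ ^ 2 < 1 ∧ c ^ 2 * (z ^ 2 + ‖w‖ ^ 2) ≤ z ^ 2} = ∅ := by
        ext w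
        simp only [Set.mem_ofPred_eq, Set.mem_empty_iff_false, iff_false, not_and]
        intro h
        nlinarith [sq_nonneg ‖w‖]
      rw [this, Set.indicator_of_notMem (by simp [hz1])]
      simp
    · have hR : 0 ≤ 1 - z ^ 2 := by nlinarith
      have : {w : EuclideanSpace ℝ (Fin 2) |
          z ^ 2 + ‖w‖ ^ 2 < 1 ∧ c ^ 2 * (z ^ 2 + ‖w‖ ^ 2) ≤ z ^ 2} =
          Metric.ball 0 (√(1 - z ^ 2)) := by
        ext w
        simp only [Set.mem_ofPred_eq, mem_ball_zero_iff]
        rw [Real.lt_sqrt (norm_nonneg _), lt_sub_iff_add_lt']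
        refine ⟨fun h => h.1, fun h => ⟨h, ?_⟩⟩
        have : c ^ 2 ≤ z ^ 2 := by have := hc.1; gcongr
        nlinarith [sq_nonneg c]
      rw [this, Set.indicator_of_mem (Set.mem_Icc.2 ⟨hzc, hz1⟩),
        EuclideanSpace.volume_ball_fin_two, ← ENNReal.ofReal_pow (Real.sqrt_nonneg _),
        Real.sq_sqrt hR, mul_comm, ENNReal.ofReal_mul Real.pi_nonneg]

lemma lintegral_slices {c : ℝ} (hc : c ∈ Set.Icc (0 : ℝ) 1) :
    ∫⁻ z, ((Set.Ico 0 c).indicator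
        (fun z => ENNReal.ofReal (Real.pi * (z ^ 2 / c ^ 2 - z ^ 2))) z +
      (Set.Icc c 1).indicator (fun z => ENNReal.ofReal (Real.pi * (1 - z ^ 2))) z) =
      ENNReal.ofReal (2 * Real.pi / 3 * (1 - c)) := by
  rw [lintegral_add_left (by
      refine Measurable.indicator ?_ measurableSet_Ico
      fun_prop),
    lintegral_indicator measurableSet_Ico, lintegral_indicator measurableSet_Icc,
    ← ofReal_integral_eq_lintegral_ofReal, ← ofReal_integral_eq_lintegral_ofReal,
    integral_Ico_eq_integral_Ioc, integral_Icc_eq_integral_Ioc,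
    ← intervalIntegral.integral_of_le hc.1, ← intervalIntegral.integral_of_le hc.2,
    ← ENNReal.ofReal_add]
  · congr 1
    simp only [intervalIntegral.integral_const_mul]
    rw [intervalIntegral.integral_sub, intervalIntegral.integral_sub,
      intervalIntegral.integral_div, integral_pow, intervalIntegral.integral_const, integral_pow]
    · rcases hc.1.eq_or_lt with h | h
      · subst h; simp; ring
      · simp; field_simp; ring
    all_goals exact Continuous.intervalIntegrable (by fun_prop) _ _
  · refine intervalIntegral.integral_nonneg hc.1 fun z hz => mul_nonneg Real.pi_nonneg ?_
    rcases hc.1.eq_or_lt with h | h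
    · have : z = 0 := le_antisymm (by rw [← h] at hz; exact hz.2) hz.1
      simp [this]
    · rw [sub_nonneg, le_div_iff₀ (by positivity)]
      nlinarith [sq_nonneg z, pow_le_one₀ hc.1 hc.2 (n := 2)]
  · refine intervalIntegral.integral_nonneg hc.2 fun z hz => mul_nonneg Real.pi_nonneg ?_
    nlinarith [hz.1, hz.2, hc.1]
  · exact (Continuous.integrableOn_Icc (by fun_prop))
  · refine (ae_restrict_iff' measurableSet_Icc).2 (Eventually.of_forall fun z hz => ?_)
    refine mul_nonneg Real.pi_nonneg ?_
    nlinarith [hz.1, hz.2, hc.1]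
  · exact (Continuous.integrableOn_Icc (by fun_prop)).mono_set Set.Ico_subset_Icc_self
  · refine (ae_restrict_iff' measurableSet_Ico).2 (Eventually.of_forall fun z hz => ?_)
    refine mul_nonneg Real.pi_nonneg ?_
    have : 0 < c := hz.1.trans_lt hz.2
    rw [sub_nonneg, le_div_iff₀ (by positivity)]
    nlinarith [sq_nonneg z, pow_le_one₀ hc.1 hc.2 (n := 2)]

/-- The sector of the unit ball around the axis `o`, with half opening angle `arccos c`. -/
def sector (o : EuclideanSpace ℝ (Fin 3)) (c : ℝ) : Set (EuclideanSpace ℝ (Fin 3)) :=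
  {v | ‖v‖ < 1 ∧ c * ‖v‖ ≤ inner ℝ o v}

lemma measurableSet_sector (o : EuclideanSpace ℝ (Fin 3)) (c : ℝ) :
    MeasurableSet (sector o c) :=
  (measurableSet_lt measurable_norm measurable_const).inter
    (measurableSet_le (measurable_norm.const_mul c) (Continuous.measurable (by fun_prop)))

lemma volume_sector_single {c : ℝ} (hc : c ∈ Set.Icc (0 : ℝ) 1) :
    volume (sector (EuclideanSpace.single 0 1) c) = ENNReal.ofReal (2 * Real.pi / 3 * (1 - c)) := by
  have hA : MeasurePreserving (fun z : ℝ × EuclideanSpace ℝ (Fin 2) =>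
      (WithLp.toLp 2 (Fin.cons z.1 (WithLp.ofLp z.2)) : EuclideanSpace ℝ (Fin 3))) := by
    have h1 : MeasurePreserving (Prod.map id (WithLp.ofLp) :
        ℝ × EuclideanSpace ℝ (Fin 2) → ℝ × (Fin 2 → ℝ)) :=
      (MeasurePreserving.id _).prod (PiLp.volume_preserving_ofLp _)
    have h2 := (volume_preserving_piFinSuccAbove (fun _ : Fin 3 => ℝ) 0).symm
    have h3 : MeasurePreserving (fun z : ℝ × EuclideanSpace ℝ (Fin 2) =>
        (Fin.cons z.1 (WithLp.ofLp z.2) : Fin 3 → ℝ)) := by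
      convert h2.comp h1 using 2 with z
      simp [MeasurableEquiv.piFinSuccAbove, Fin.insertNthEquiv]
    exact (PiLp.volume_preserving_toLp _).comp h3
  rw [← hA.measure_preimage (measurableSet_sector _ _).nullMeasurableSet,
    Measure.volume_eq_prod, Measure.prod_apply (hA.measurable (measurableSet_sector _ _)),
    ← lintegral_slices hc]
  refine lintegral_congr fun z => ?_
  rw [← volume_slice hc]
  congr 1
  ext w
  have hn : ‖(WithLp.toLp 2 (Fin.cons z (WithLp.ofLp w)) : EuclideanSpace ℝ (Fin 3))‖ =
      √(z ^ 2 + ‖w‖ ^ 2) := by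
    rw [EuclideanSpace.norm_eq, EuclideanSpace.norm_sq_eq]
    simp [Fin.sum_univ_succ]
  simp only [sector, Set.mem_preimage, Set.mem_ofPred_eq, hn]
  rw [EuclideanSpace.inner_single_left, Real.sqrt_lt' one_pos]
  simp

lemma volume_sector {o : EuclideanSpace ℝ (Fin 3)} (ho : ‖o‖ = 1) {c : ℝ}
    (hc : c ∈ Set.Icc (0 : ℝ) 1) :
    volume (sector o c) = ENNReal.ofReal (2 * Real.pi / 3 * (1 - c)) := by
  have hne : ‖o‖ = ‖(EuclideanSpace.single 0 1 : EuclideanSpace ℝ (Fin 3))‖ := by simp [ho]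
  -- The reflection that exchanges `o` with the first basis vector maps one sector to the other.
  let R := (ℝ ∙ (o - EuclideanSpace.single 0 1))ᗮ.reflection
  have hR : R o = EuclideanSpace.single 0 1 := Submodule.reflection_sub hne
  rw [← volume_sector_single hc,
    ← R.measurePreserving.measure_preimage
      (measurableSet_sector (EuclideanSpace.single 0 1) c).nullMeasurableSet]
  congr 1
  ext v
  simp only [sector, Set.mem_preimage, Set.mem_ofPred_eq, R.norm_map, ← hR]
  rw [R.inner_map_map]

open scoped Pointwise in
/-- The area of a cap that is at most a hemisphere, obtained from the volume of the cone over it. -/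
lemma area_inner_ge {c : ℝ} (hc : c ∈ Set.Icc (0 : ℝ) 1) (o : S2) :
    area.real {y | c ≤ inner ℝ (o : EuclideanSpace ℝ (Fin 3)) (y : EuclideanSpace ℝ (Fin 3))} =
      2 * Real.pi * (1 - c) := by
  have hm : MeasurableSet {y : S2 |
      c ≤ inner ℝ (o : EuclideanSpace ℝ (Fin 3)) (y : EuclideanSpace ℝ (Fin 3))} :=
    measurableSet_le measurable_const (Continuous.measurable (by fun_prop))
  rw [measureReal_def, area, Measure.toSphere_apply' _ hm]
  have hset : Set.Ioo (0 : ℝ) 1 • ((↑) '' {y : S2 | c ≤ inner ℝ (o : EuclideanSpace ℝ (Fin 3))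
      (y : EuclideanSpace ℝ (Fin 3))} : Set (EuclideanSpace ℝ (Fin 3))) =
      sector o c \ {0} := by
    ext v
    simp only [Set.mem_smul, Set.mem_image, Set.mem_ofPred_eq, sector, Set.mem_sdiff,
      Set.mem_singleton_iff]
    constructor
    · rintro ⟨t, ht, _, ⟨y, hy, rfl⟩, rfl⟩
      have hy1 : ‖(y : EuclideanSpace ℝ (Fin 3))‖ = 1 := by simp
      rw [norm_smul, hy1, inner_smul_right, mul_one, Real.norm_of_nonneg ht.1.le]
      refine ⟨⟨ht.2, ?_⟩, smul_ne_zero ht.1.ne' (norm_ne_zero_iff.1 (by simp))⟩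
      rw [mul_comm]
      exact mul_le_mul_of_nonneg_left hy ht.1.le
    · rintro ⟨⟨h1, h2⟩, h0⟩
      have hv : 0 < ‖v‖ := norm_pos_iff.2 h0
      refine ⟨‖v‖, ⟨hv, h1⟩, ‖v‖⁻¹ • v, ⟨⟨‖v‖⁻¹ • v, ?_⟩, ?_, rfl⟩, ?_⟩
      · simp [norm_smul, hv.ne']
      · simp only [inner_smul_right]
        rw [inv_mul_eq_div, le_div_iff₀ hv]
        exact h2
      · rw [smul_smul, mul_inv_cancel₀ hv.ne', one_smul]
  rw [hset, measure_sdiff_null (measure_singleton _), volume_sector (by simp) hc]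
  have : 0 ≤ 2 * Real.pi / 3 * (1 - c) :=
    mul_nonneg (by positivity) (by linarith [hc.2])
  simp [ENNReal.toReal_ofReal this]
  ring

lemma area_real_univ : area.real Set.univ = 4 * Real.pi := by
  rw [area, Measure.toSphere_real_apply_univ, measureReal_def,
    EuclideanSpace.volume_ball_fin_three]
  simp
  rw [ENNReal.toReal_ofReal (by positivity)]
  ring

lemma measurableSet_cap (o : S2) (r : ℝ) : MeasurableSet (cap o r) := by
  have h : Measurable (geoDist o) := measurable_geoDist.of_uncurry_left
  exact h measurableSet_Iic

/-- Archimedes' formula for the area of a spherical cap. -/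
lemma area_cap {r : ℝ} (hr : r ∈ Set.Icc 0 Real.pi) (o : S2) :
    area.real (cap o r) = 2 * Real.pi * (1 - Real.cos r) := by
  have hcap : cap o r = {y : S2 | Real.cos r ≤
      inner ℝ (o : EuclideanSpace ℝ (Fin 3)) (y : EuclideanSpace ℝ (Fin 3))} := by
    ext y; exact mem_cap_iff hr
  rcases le_or_gt 0 (Real.cos r) with hc | hc
  · rw [hcap, area_inner_ge ⟨hc, Real.cos_le_one r⟩]
  -- A cap larger than a hemisphere is the complement of an open cap around the antipode, whose
  -- area is squeezed between the areas of closed caps.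
  set o' : S2 := ⟨-o, by simp⟩ with ho'
  have hcompl : (cap o r)ᶜ = {y : S2 | -Real.cos r <
      inner ℝ (o' : EuclideanSpace ℝ (Fin 3)) (y : EuclideanSpace ℝ (Fin 3))} := by
    ext y
    rw [hcap]
    simp [ho', inner_neg_left]
  have h1 : area.real (cap o r)ᶜ = 2 * Real.pi * (1 - -Real.cos r) := by
    rw [hcompl]
    refine le_antisymm ?_ ?_
    · rw [← area_inner_ge ⟨by linarith, by linarith [Real.neg_one_le_cos r]⟩ o']
      refine measureReal_mono fun y hy => ?_
      rw [Set.mem_ofPred_eq] at hy ⊢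
      exact hy.le
    · rcases (Real.neg_one_le_cos r).eq_or_lt with h | h
      · rw [← h]; simp
      have hlim : Tendsto (fun c : ℝ => 2 * Real.pi * (1 - c)) (𝓝[>] (-Real.cos r))
          (𝓝 (2 * Real.pi * (1 - -Real.cos r))) :=
        (Continuous.tendsto (by fun_prop) _).mono_left nhdsWithin_le_nhds
      refine le_of_tendsto hlim ?_
      filter_upwards [Ioo_mem_nhdsGT (show -Real.cos r < 1 by linarith)] with c hc'
      rw [← area_inner_ge ⟨by linarith [hc'.1], hc'.2.le⟩ o']
      refine measureReal_mono fun y hy => ?_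
      rw [Set.mem_ofPred_eq] at hy ⊢
      exact hc'.1.trans_le hy
  have h2 := measureReal_compl (μ := area) (measurableSet_cap o r)
  rw [area_real_univ, h1] at h2
  linarith

instance : NullSingletonClass area where
  measure_singleton x := by
    have h : area.real (cap x 0) = 0 := by
      rw [area_cap ⟨le_rfl, Real.pi_nonneg⟩]; simp
    refine measure_mono_null ?_ ((measureReal_eq_zero_iff).1 h)
    rintro _ rfl
    simp only [cap, geoDist, Set.mem_ofPred_eq]
    rw [InnerProductGeometry.angle_self (norm_ne_zero_iff.1 (by simp))]

/-! ### The exponential integral and the functions `ψ₁`, `ψ₂`, `ψ₃` as power series -/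

/-- The integral is the derivative of the Gamma function at `1`. -/
lemma integral_exp_neg_mul_log :
    ∫ t in Set.Ioi (0 : ℝ), Real.exp (-t) * Real.log t = -Real.eulerMascheroniConstant := by
  have h1 := Complex.hasDerivAt_GammaIntegral (s := 1) (by simp)
  have h2 : HasDerivAt Complex.GammaIntegral (-Real.eulerMascheroniConstant) 1 := by
    refine Complex.hasDerivAt_Gamma_one.congr_of_eventuallyEq ?_
    have : {s : ℂ | 0 < s.re} ∈ 𝓝 (1 : ℂ) :=
      (isOpen_lt continuous_const Complex.continuous_re).mem_nhds (by simp)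
    filter_upwards [this] with s hs
    exact (Complex.Gamma_eq_integral hs).symm
  have h3 := h1.unique h2
  have h4 : ∫ t in Set.Ioi (0 : ℝ), ((Real.exp (-t) * Real.log t : ℝ) : ℂ) =
      -Real.eulerMascheroniConstant := by
    rw [← h3]
    refine integral_congr_ae (Eventually.of_forall fun t => ?_)
    simp [mul_comm]
  rw [integral_complex_ofReal] at h4
  exact_mod_cast h4

/-- The integral in `integral_exp_neg_mul_log` is nonzero, hence converges. -/
lemma integrableOn_exp_neg_mul_log :
    IntegrableOn (fun t : ℝ => Real.exp (-t) * Real.log t) (Set.Ioi 0) := by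
  by_contra h
  have h1 := integral_exp_neg_mul_log
  rw [integral_undef h] at h1
  linarith [Real.one_half_lt_eulerMascheroniConstant]

lemma integrableOn_exp_neg_div {ε : ℝ} (hε : 0 < ε) :
    IntegrableOn (fun t : ℝ => Real.exp (-t) / t) (Set.Ioi ε) := by
  refine ((integrableOn_exp_neg_Ioi ε).div_const ε).mono' ?_ ?_
  · exact (Measurable.div (by fun_prop) measurable_id).aestronglyMeasurable
  · refine (ae_restrict_iff' measurableSet_Ioi).2 (Eventually.of_forall fun t ht => ?_)
    have ht' : 0 < t := hε.trans ht
    rw [Real.norm_of_nonneg (by positivity)]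
    exact div_le_div_of_nonneg_left (Real.exp_pos _).le hε (le_of_lt ht)

lemma integral_exp_neg_div {ε : ℝ} (hε : 0 < ε) :
    ∫ t in Set.Ioi ε, Real.exp (-t) / t =
      (∫ t in Set.Ioi ε, Real.exp (-t) * Real.log t) - Real.exp (-ε) * Real.log ε := by
  have hlog : IntegrableOn (fun t : ℝ => Real.exp (-t) * Real.log t) (Set.Ioi ε) :=
    integrableOn_exp_neg_mul_log.mono_set (Set.Ioi_subset_Ioi hε.le)
  have hlim : Tendsto (fun t : ℝ => Real.exp (-t) * Real.log t) atTop (𝓝 0) := by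
    have h1 := Real.tendsto_pow_mul_exp_neg_atTop_nhds_zero 1
    refine squeeze_zero' ?_ ?_ h1
    · filter_upwards [eventually_ge_atTop 1] with t ht
      exact mul_nonneg (Real.exp_pos _).le (Real.log_nonneg ht)
    · filter_upwards [eventually_gt_atTop 0] with t ht
      rw [pow_one, mul_comm]
      exact mul_le_mul_of_nonneg_right (by linarith [Real.log_le_sub_one_of_pos ht])
        (Real.exp_pos _).le
  have := integral_Ioi_of_hasDerivAt_of_tendsto' (a := ε)
    (f := fun t : ℝ => Real.exp (-t) * Real.log t)
    (f' := fun t => Real.exp (-t) / t - Real.exp (-t) * Real.log t) (fun t ht => ?_)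
    ((integrableOn_exp_neg_div hε).sub hlog) hlim
  · rw [integral_sub (integrableOn_exp_neg_div hε) hlog] at this
    linarith
  · have ht' : t ≠ 0 := (hε.trans_le ht).ne'
    have h1 : HasDerivAt (fun t : ℝ => Real.exp (-t)) (-Real.exp (-t)) t := by
      simpa using (hasDerivAt_neg t).exp
    refine (h1.mul (Real.hasDerivAt_log ht')).congr_deriv ?_
    rw [div_eq_mul_inv]
    ring

lemma tendsto_log_add_integral_exp_neg_div :
    Tendsto (fun ε : ℝ => Real.log ε + ∫ t in Set.Ioi ε, Real.exp (-t) / t) (𝓝[>] 0)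
      (𝓝 (-Real.eulerMascheroniConstant)) := by
  have h1 : Tendsto (fun ε : ℝ => (1 - Real.exp (-ε)) * Real.log ε) (𝓝[>] 0) (𝓝 0) := by
    have h := tendsto_log_mul_rpow_nhdsGT_zero zero_lt_one
    rw [← tendsto_neg_iff, neg_zero]
    have h' := h.neg
    rw [neg_zero] at h'
    refine squeeze_zero' ?_ ?_ h'
    · filter_upwards [Ioo_mem_nhdsGT (zero_lt_one (α := ℝ))] with ε hε
      have := Real.log_nonpos hε.1.le hε.2.le
      have h3 : Real.exp (-ε) ≤ 1 := Real.exp_le_one_iff.2 (by linarith [hε.1])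
      nlinarith
    · filter_upwards [Ioo_mem_nhdsGT (zero_lt_one (α := ℝ))] with ε hε
      have := Real.log_nonpos hε.1.le hε.2.le
      have h3 := Real.add_one_le_exp (-ε)
      rw [Real.rpow_one]
      nlinarith
  have h2 : Tendsto (fun ε : ℝ => ∫ t in Set.Ioi ε, Real.exp (-t) * Real.log t) (𝓝[>] 0)
      (𝓝 (-Real.eulerMascheroniConstant)) := by
    rw [← integral_exp_neg_mul_log]
    have h3 : Continuous fun ε : ℝ => ∫ t in (0 : ℝ)..ε,
        (Set.Ioi (0 : ℝ)).indicator (fun t => Real.exp (-t) * Real.log t) t :=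
      intervalIntegral.continuous_primitive (fun a b =>
        ((integrable_indicator_iff measurableSet_Ioi).2
          integrableOn_exp_neg_mul_log).intervalIntegrable) 0
    have h4 : Tendsto (fun ε : ℝ => (∫ t in Set.Ioi (0 : ℝ), Real.exp (-t) * Real.log t) -
        ∫ t in (0 : ℝ)..ε, (Set.Ioi (0 : ℝ)).indicator
          (fun t => Real.exp (-t) * Real.log t) t) (𝓝[>] 0)
        (𝓝 ((∫ t in Set.Ioi (0 : ℝ), Real.exp (-t) * Real.log t) - 0)) := by
      refine tendsto_const_nhds.sub ?_
      have := (h3.tendsto 0).mono_left (nhdsWithin_le_nhds (s := Set.Ioi 0))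
      simpa using this
    rw [sub_zero] at h4
    refine h4.congr' ?_
    filter_upwards [self_mem_nhdsWithin] with ε (hε : 0 < ε)
    rw [sub_eq_iff_eq_add', ← sub_eq_iff_eq_add,
      intervalIntegral.integral_Ioi_sub_Ioi integrableOn_exp_neg_mul_log hε.le]
    refine intervalIntegral.integral_congr_ae (Eventually.of_forall fun t ht => ?_)
    rw [Set.uIoc_of_le hε.le] at ht
    rw [Set.indicator_of_mem (show t ∈ Set.Ioi (0 : ℝ) from ht.1)]
  have h5 := h1.add h2
  rw [zero_add] at h5
  refine h5.congr' ?_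
  filter_upwards [self_mem_nhdsWithin] with ε (hε : 0 < ε)
  rw [integral_exp_neg_div hε]
  ring

lemma hasSum_exp_sub_one_div {u : ℝ} (hu : u ≠ 0) :
    HasSum (fun n : ℕ => u ^ n / (n + 1).factorial) ((Real.exp u - 1) / u) := by
  have h := NormedSpace.expSeries_div_hasSum_exp (𝔸 := ℝ) u
  rw [← Real.exp_eq_exp_ℝ, ← hasSum_nat_add_iff' 1] at h
  have h' := h.div_const u
  simp only [Finset.range_one, Finset.sum_singleton, pow_zero, Nat.factorial_zero, Nat.cast_one,
    div_one] at h'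
  refine h'.congr_fun ?_
  intro n
  rw [pow_succ]
  field_simp

lemma dslope_exp {u : ℝ} (hu : u ≠ 0) : dslope Real.exp 0 u = (Real.exp u - 1) / u := by
  rw [dslope_of_ne _ hu, slope_def_field]
  simp

lemma continuous_dslope_exp : Continuous (dslope Real.exp 0) := by
  rw [← continuousOn_univ, continuousOn_dslope univ_mem]
  exact ⟨Real.continuous_exp.continuousOn, Real.differentiableAt_exp⟩

lemma hasSum_integral_dslope_exp {x : ℝ} (hx : 0 ≤ x) :
    HasSum (fun n : ℕ => x ^ (n + 1) / ((n + 1) * (n + 1).factorial))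
      (∫ u in (0 : ℝ)..x, dslope Real.exp 0 u) := by
  have hs : Summable fun n : ℕ => x ^ n / (n + 1).factorial := by
    refine Summable.of_nonneg_of_le (fun n => by positivity) (fun n => ?_)
      (Real.summable_pow_div_factorial x)
    gcongr
    omega
  have := intervalIntegral.hasSum_integral_of_dominated_convergence (a := 0) (b := x)
    (μ := volume) (F := fun (n : ℕ) u => u ^ n / (n + 1).factorial) (f := dslope Real.exp 0)
    (fun n _ => x ^ n / (n + 1).factorial) (fun n => ?_) (fun n => ?_) ?_ ?_ ?_
  · refine this.congr_fun fun n => ?_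
    rw [intervalIntegral.integral_div, integral_pow]
    simp
    field_simp
  · exact Continuous.aestronglyMeasurable (by fun_prop)
  · refine Eventually.of_forall fun t ht => ?_
    rw [Set.uIoc_of_le hx] at ht
    rw [Real.norm_of_nonneg (by have := ht.1.le; positivity)]
    have := ht.1.le
    have := ht.2
    gcongr
  · exact Eventually.of_forall fun _ _ => hs
  · exact intervalIntegrable_const
  · refine Eventually.of_forall fun t ht => ?_
    rw [Set.uIoc_of_le hx] at ht
    rw [dslope_exp ht.1.ne']
    exact hasSum_exp_sub_one_div ht.1.ne'

/-- The truncated principal value integral, with the singular part `1 / u` of `e^u / u` split off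
and integrated to a logarithm; `dslope Real.exp 0 u` is `(e^u - 1) / u`. -/
lemma Ei_truncated {x ε : ℝ} (hε : 0 < ε) (hx : ε < x) :
    -∫ t in {t : ℝ | -x < t ∧ ε < |t|}, Real.exp (-t) / t =
      (∫ u in ε..x, dslope Real.exp 0 u) + Real.log x -
        (Real.log ε + ∫ t in Set.Ioi ε, Real.exp (-t) / t) := by
  have hset : {t : ℝ | -x < t ∧ ε < |t|} = Set.Ioo (-x) (-ε) ∪ Set.Ioi ε := by
    ext t
    simp only [Set.mem_ofPred_eq, Set.mem_union, Set.mem_Ioo, Set.mem_Ioi, lt_abs]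
    constructor
    · rintro ⟨h1, h2 | h2⟩
      · exact Or.inr h2
      · exact Or.inl ⟨h1, by linarith⟩
    · rintro (⟨h1, h2⟩ | h2)
      · exact ⟨h1, Or.inr (by linarith)⟩
      · exact ⟨by linarith, Or.inl h2⟩
  have hcont : ContinuousOn (fun t : ℝ => Real.exp (-t) / t) (Set.Icc (-x) (-ε)) := by
    refine ContinuousOn.div (by fun_prop) continuousOn_id fun t ht => ?_
    exact ne_of_lt (ht.2.trans_lt (by linarith))
  have hint : IntegrableOn (fun t : ℝ => Real.exp (-t) / t) (Set.Ioo (-x) (-ε)) :=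
    (hcont.integrableOn_compact isCompact_Icc).mono_set Set.Ioo_subset_Icc_self
  have hneg : ∫ t in Set.Ioo (-x) (-ε), Real.exp (-t) / t =
      -∫ u in ε..x, Real.exp u / u := by
    rw [← integral_Ioc_eq_integral_Ioo, ← intervalIntegral.integral_of_le (by linarith)]
    have := intervalIntegral.integral_comp_neg (a := -x) (b := -ε) fun u : ℝ => Real.exp u / u
    rw [neg_neg, neg_neg] at this
    rw [← this, ← intervalIntegral.integral_neg]
    refine intervalIntegral.integral_congr fun t _ => ?_
    simp [div_neg]
  have hsplit : ∫ u in ε..x, Real.exp u / u =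
      (∫ u in ε..x, dslope Real.exp 0 u) + (Real.log x - Real.log ε) := by
    rw [← Real.log_div (by linarith) hε.ne', ← integral_inv_of_pos hε (hε.trans hx),
      ← intervalIntegral.integral_add (continuous_dslope_exp.intervalIntegrable _ _)]
    · refine intervalIntegral.integral_congr fun u hu => ?_
      rw [Set.uIcc_of_le hx.le] at hu
      have : u ≠ 0 := (hε.trans_le hu.1).ne'
      rw [dslope_exp this]
      field_simp
      ring
    · refine ContinuousOn.intervalIntegrable fun u hu => ?_
      rw [Set.uIcc_of_le hx.le] at hu
      exact (continuousAt_inv₀ (hε.trans_le hu.1).ne').continuousWithinAt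
  rw [hset, setIntegral_union _ measurableSet_Ioi hint (integrableOn_exp_neg_div hε), hneg, hsplit]
  · ring
  · refine Set.disjoint_left.2 fun t h1 h2 => ?_
    have := h1.2
    rw [Set.mem_Ioi] at h2
    linarith

lemma Ei_eq {x : ℝ} (hx : 0 < x) :
    Ei x = (∫ u in (0 : ℝ)..x, dslope Real.exp 0 u) + Real.log x +
      Real.eulerMascheroniConstant := by
  refine Tendsto.limUnder_eq ?_
  have h1 : Tendsto (fun ε : ℝ => ∫ u in ε..x, dslope Real.exp 0 u) (𝓝[>] 0)
      (𝓝 (∫ u in (0 : ℝ)..x, dslope Real.exp 0 u)) := by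
    have h : Continuous fun ε : ℝ => ∫ u in x..ε, dslope Real.exp 0 u :=
      intervalIntegral.continuous_primitive
        (fun a b => continuous_dslope_exp.intervalIntegrable _ _) x
    have h' : Continuous fun ε : ℝ => ∫ u in ε..x, dslope Real.exp 0 u :=
      h.neg.congr fun ε => (intervalIntegral.integral_symm _ _).symm
    exact (h'.tendsto 0).mono_left nhdsWithin_le_nhds
  have h2 := (h1.add_const (Real.log x)).sub tendsto_log_add_integral_exp_neg_div
  rw [sub_neg_eq_add] at h2
  refine h2.congr' ?_
  filter_upwards [Ioo_mem_nhdsGT hx] with ε hε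
  exact (Ei_truncated hε.1 hε.2).symm

/-- The power series of the entire exponential integral. -/
lemma hasSum_Ei {x : ℝ} (hx : 0 < x) :
    HasSum (fun n : ℕ => x ^ (n + 1) / ((n + 1) * (n + 1).factorial))
      (Ei x - Real.eulerMascheroniConstant - Real.log x) := by
  convert hasSum_integral_dslope_exp hx.le using 1
  rw [Ei_eq hx]
  ring

section Psi

variable {m A : ℝ}

/- The functions `ψ₃ / m`, `ψ₂ / m` and `ψ₁ / m²` at `A` are the means of `A ^ N / (N + 1)`,
`A ^ N / (N + 1) ^ 2` and `A ^ N / (N + 2) ^ 2` for a Poisson variable `N` with mean `m`. -/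

lemma hasSum_psi3 (hm : 0 < m) (hA : 0 ≤ A) :
    HasSum (fun n : ℕ => Real.exp (-m) * m ^ n / n.factorial * (1 / (n + 1) * A ^ n))
      (psi3 m A / m) := by
  rcases hA.eq_or_lt with rfl | hA
  · have := hasSum_single (f := fun n : ℕ =>
      Real.exp (-m) * m ^ n / n.factorial * (1 / (n + 1) * (0 : ℝ) ^ n)) 0
      (fun n hn => by simp [hn])
    convert this using 1
    simp [psi3, hm.ne']
  · have h := (hasSum_exp_sub_one_div (mul_pos hm hA).ne').mul_left (Real.exp (-m))
    have hv : psi3 m A / m = Real.exp (-m) * ((Real.exp (m * A) - 1) / (m * A)) := by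
      rw [psi3, if_neg hA.ne']
      field_simp
    rw [hv]
    refine h.congr_fun fun n => ?_
    rw [Nat.factorial_succ, mul_pow]
    push_cast
    field_simp

lemma hasSum_psi2 (hm : 0 < m) (hA : 0 ≤ A) :
    HasSum (fun n : ℕ => Real.exp (-m) * m ^ n / n.factorial * (1 / (n + 1) ^ 2 * A ^ n))
      (psi2 m A / m) := by
  rcases hA.eq_or_lt with rfl | hA
  · have := hasSum_single (f := fun n : ℕ =>
      Real.exp (-m) * m ^ n / n.factorial * (1 / (n + 1) ^ 2 * (0 : ℝ) ^ n)) 0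
      (fun n hn => by simp [hn])
    convert this using 1
    simp [psi2, hm.ne']
  · have h := (hasSum_Ei (mul_pos hm hA)).mul_left (Real.exp (-m) / (m * A))
    have hv : psi2 m A / m = Real.exp (-m) / (m * A) *
        (Ei (m * A) - Real.eulerMascheroniConstant - Real.log (m * A)) := by
      rw [psi2, if_neg hA.ne']
      field_simp
    rw [hv]
    refine h.congr_fun fun n => ?_
    rw [Nat.factorial_succ, mul_pow]
    push_cast
    field_simp
    ring

lemma hasSum_psi1 (hm : 0 < m) (hA : 0 ≤ A) :
    HasSum (fun n : ℕ => Real.exp (-m) * m ^ n / n.factorial * (1 / (n + 2) ^ 2 * A ^ n))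
      (psi1 m A / m ^ 2) := by
  rcases hA.eq_or_lt with rfl | hA
  · have := hasSum_single (f := fun n : ℕ =>
      Real.exp (-m) * m ^ n / n.factorial * (1 / (n + 2) ^ 2 * (0 : ℝ) ^ n)) 0
      (fun n hn => by simp [hn])
    convert this using 1
    simp [psi1]
    field_simp
    norm_num
  · have hx := mul_pos hm hA
    have h := (((hasSum_exp_sub_one_div hx.ne').mul_left (m * A)).sub (hasSum_Ei hx)).mul_left
      (Real.exp (-m) / (m * A) ^ 2)
    -- The terms of index `0` cancel; dropping them produces the shift from `n + 1` to `n + 2`.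
    rw [← hasSum_nat_add_iff' 1] at h
    have hv : psi1 m A / m ^ 2 = Real.exp (-m) / (m * A) ^ 2 *
        (m * A * ((Real.exp (m * A) - 1) / (m * A)) -
          (Ei (m * A) - Real.eulerMascheroniConstant - Real.log (m * A))) -
        ∑ i ∈ Finset.range 1, Real.exp (-m) / (m * A) ^ 2 *
          (m * A * ((m * A) ^ i / (i + 1).factorial) -
            (m * A) ^ (i + 1) / ((i + 1) * (i + 1).factorial)) := by
      rw [psi1, if_neg hA.ne', mul_div_cancel₀ _ hx.ne']
      simp
      field_simp
      ring
    rw [hv]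
    refine h.congr_fun fun n => ?_
    rw [Nat.factorial_succ, Nat.factorial_succ, mul_pow]
    push_cast
    field_simp
    ring

end Psi

/-! ### Integrals with respect to the intensity measure -/

section Intensity

variable {ρ : S2 → ℝ}

lemma infIntensity_le (hρ_pos : 0 < infIntensity ρ) (x : S2) : infIntensity ρ ≤ ρ x := by
  refine ciInf_le ?_ x
  -- An infimum over a set that is not bounded below has the value `0`.
  by_contra h
  rw [infIntensity, Real.iInf_of_not_bddBelow h] at hρ_pos
  exact lt_irrefl _ hρ_pos

lemma pos_of_infIntensity_pos (hρ_pos : 0 < infIntensity ρ) (x : S2) : 0 < ρ x :=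
  hρ_pos.trans_le (infIntensity_le hρ_pos x)

lemma totalMass_pos (hρ_int : Integrable ρ area) (hρ_pos : 0 < infIntensity ρ) :
    0 < totalMass ρ := by
  have h : ∫ _, infIntensity ρ ∂area ≤ totalMass ρ :=
    integral_mono (integrable_const _) hρ_int fun x => infIntensity_le hρ_pos x
  rw [integral_const, area_real_univ, smul_eq_mul] at h
  have := Real.pi_pos
  exact lt_of_lt_of_le (by positivity) h

lemma intensityMeasure_univ (hρ_int : Integrable ρ area) (hρ_pos : 0 < infIntensity ρ) :
    intensityMeasure ρ Set.univ = ENNReal.ofReal (totalMass ρ) := by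
  rw [intensityMeasure, withDensity_apply _ MeasurableSet.univ, Measure.restrict_univ, totalMass,
    ofReal_integral_eq_lintegral_ofReal hρ_int
      (Eventually.of_forall fun x => (pos_of_infIntensity_pos hρ_pos x).le)]

lemma intensityMeasure_univ_ne_zero (hρ_int : Integrable ρ area) (hρ_pos : 0 < infIntensity ρ) :
    intensityMeasure ρ Set.univ ≠ 0 := by
  rw [intensityMeasure_univ hρ_int hρ_pos]
  simpa using totalMass_pos hρ_int hρ_pos

lemma intensityMeasure_univ_ne_top (hρ_int : Integrable ρ area) (hρ_pos : 0 < infIntensity ρ) :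
    intensityMeasure ρ Set.univ ≠ ⊤ := by
  rw [intensityMeasure_univ hρ_int hρ_pos]
  exact ENNReal.ofReal_ne_top

lemma poissonWeight_eq (hρ_int : Integrable ρ area) (hρ_pos : 0 < infIntensity ρ) (n : ℕ) :
    poissonWeight ρ n =
      ENNReal.ofReal (Real.exp (-totalMass ρ) * totalMass ρ ^ n / n.factorial) := by
  rw [poissonWeight, poissonMeasure_singleton, intensityMeasure_univ hρ_int hρ_pos]
  have h : ((ENNReal.ofReal (totalMass ρ)).toNNReal : ℝ) = totalMass ρ :=
    ENNReal.toReal_ofReal (totalMass_pos hρ_int hρ_pos).le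
  rw [h]

lemma lintegral_intensityMeasure (hρ_meas : Measurable ρ) {f : S2 → ℝ≥0∞} (hf : Measurable f) :
    ∫⁻ x, f x ∂(intensityMeasure ρ) = ∫⁻ x, ENNReal.ofReal (ρ x) * f x ∂area := by
  rw [intensityMeasure, lintegral_withDensity_eq_lintegral_mul _ hρ_meas.ennreal_ofReal hf]
  rfl

lemma lintegral_pointLaw (hρ_meas : Measurable ρ) (hρ_int : Integrable ρ area)
    (hρ_pos : 0 < infIntensity ρ) {f : S2 → ℝ} (hf : Measurable f)
    (hf0 : ∀ x, 0 ≤ f x) (hfi : Integrable (fun x => ρ x * f x) area) :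
    ∫⁻ x, ENNReal.ofReal (f x) ∂(pointLaw ρ) =
      ENNReal.ofReal ((∫ x, ρ x * f x ∂area) / totalMass ρ) := by
  rw [pointLaw, ProbabilityTheory.cond, Measure.restrict_univ, lintegral_smul_measure,
    lintegral_intensityMeasure hρ_meas hf.ennreal_ofReal, intensityMeasure_univ hρ_int hρ_pos,
    ← ENNReal.ofReal_inv_of_pos (totalMass_pos hρ_int hρ_pos), smul_eq_mul, div_eq_inv_mul,
    ENNReal.ofReal_mul (by have := totalMass_pos hρ_int hρ_pos; positivity),
    ofReal_integral_eq_lintegral_ofReal hfi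
      (Eventually.of_forall fun x => mul_nonneg (pos_of_infIntensity_pos hρ_pos x).le (hf0 x))]
  congr 1
  exact lintegral_congr fun x =>
    (ENNReal.ofReal_mul (pos_of_infIntensity_pos hρ_pos x).le).symm

lemma integrable_one_div (hρ_meas : Measurable ρ) (hρ_pos : 0 < infIntensity ρ) :
    Integrable (fun x => 1 / ρ x) area := by
  refine (integrable_const (1 / infIntensity ρ)).mono'
    (measurable_const.div hρ_meas).aestronglyMeasurable (Eventually.of_forall fun x => ?_)
  have := pos_of_infIntensity_pos hρ_pos x
  rw [Real.norm_of_nonneg (by positivity)]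
  exact one_div_le_one_div_of_le hρ_pos (infIntensity_le hρ_pos x)

lemma isFiniteMeasure_intensityMeasure (hρ_int : Integrable ρ area)
    (hρ_pos : 0 < infIntensity ρ) : IsFiniteMeasure (intensityMeasure ρ) :=
  ⟨(intensityMeasure_univ_ne_top hρ_int hρ_pos).lt_top⟩

end Intensity

/-- Finite first and second moments of an extended nonnegative variable give its variance. -/
lemma variance_toReal {Ω : Type*} [MeasurableSpace Ω] {P : Measure Ω} [IsProbabilityMeasure P]
    {Z : Ω → ℝ≥0∞} (hZ : Measurable Z) {e v : ℝ} (he : 0 ≤ e) (hv : 0 ≤ v)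
    (h1 : ∫⁻ ω, Z ω ∂P = ENNReal.ofReal e) (h2 : ∫⁻ ω, Z ω ^ 2 ∂P = ENNReal.ofReal v) :
    MemLp (fun ω => (Z ω).toReal) 2 P ∧ variance (fun ω => (Z ω).toReal) P = v - e ^ 2 := by
  have hm : AEStronglyMeasurable (fun ω => (Z ω).toReal) P :=
    hZ.ennreal_toReal.aestronglyMeasurable
  have hsq : ∀ ω, (Z ω).toReal ^ 2 = (Z ω ^ 2).toReal := fun ω => (ENNReal.toReal_pow _ _).symm
  have hL : MemLp (fun ω => (Z ω).toReal) 2 P := by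
    rw [memLp_two_iff_integrable_sq hm]
    simp_rw [hsq]
    exact integrable_toReal_of_lintegral_ne_top (hZ.pow_const 2).aemeasurable
      (h2 ▸ ENNReal.ofReal_ne_top)
  refine ⟨hL, ?_⟩
  rw [variance_eq_sub hL]
  simp only [Pi.pow_apply, hsq]
  rw [integral_toReal (hZ.pow_const 2).aemeasurable
      (ae_lt_top (hZ.pow_const 2) (h2 ▸ ENNReal.ofReal_ne_top)),
    integral_toReal hZ.aemeasurable (ae_lt_top hZ (h1 ▸ ENNReal.ofReal_ne_top)), h1, h2,
    ENNReal.toReal_ofReal he, ENNReal.toReal_ofReal hv]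

/-! ### Sums over pairs of points -/

section PairSums

/-- The sum of `g a b` over the points `b` of a pattern. -/
def pointSum (g : S2 → S2 → ℝ≥0∞) (a : S2) (x : Finset S2) : ℝ≥0∞ := ∑ b ∈ x, g a b

open scoped Classical in
/-- The sum of `g a b` over the ordered pairs of distinct points `a`, `b` of a pattern. -/
def pairSum (g : S2 → S2 → ℝ≥0∞) (x : Finset S2) : ℝ≥0∞ := ∑ a ∈ x, pointSum g a (x.erase a)

variable {g : S2 → S2 → ℝ≥0∞}

open scoped Classical in
lemma pointSum_of_mem (c : S2) {a : S2} {x : Finset S2} (ha : a ∈ x) :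
    pointSum g c x = g c a + pointSum g c (x.erase a) :=
  (Finset.add_sum_erase x (g c) ha).symm

open scoped Classical in
lemma pairSum_of_mem (hsym : ∀ a b, g a b = g b a) {a : S2} {x : Finset S2} (ha : a ∈ x) :
    pairSum g x = pairSum g (x.erase a) + 2 * pointSum g a (x.erase a) := by
  have h : ∀ b ∈ x.erase a, pointSum g b (x.erase b) =
      g a b + pointSum g b ((x.erase a).erase b) := by
    intro b hb
    have hab : a ∈ x.erase b := Finset.mem_erase.2 ⟨(Finset.ne_of_mem_erase hb).symm, ha⟩
    rw [pointSum_of_mem b hab, hsym b a, Finset.erase_right_comm]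
  rw [pairSum, ← Finset.add_sum_erase x _ ha, Finset.sum_congr rfl h, Finset.sum_add_distrib]
  change pointSum g a (x.erase a) + (pointSum g a (x.erase a) + pairSum g (x.erase a)) = _
  ring

lemma measurable_pointSum (hg : Measurable (Function.uncurry g)) :
    Measurable (Function.uncurry (pointSum g)) :=
  measurable_sum_erase_pattern (T := S2) (φ := fun a b _ => g a b)
    (hg.comp (measurable_fst.prodMk (measurable_fst.comp measurable_snd)))

lemma measurable_pairSum (hg : Measurable (Function.uncurry g)) : Measurable (pairSum g) :=
  measurable_sum_erase_pattern' (measurable_pointSum hg)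

variable {Ω : Type*} [MeasurableSpace Ω] {P : Measure Ω} [IsProbabilityMeasure P]
  {X : Ω → Finset S2} {ρ : S2 → ℝ}

lemma IsPoissonProcess.lintegral_pointSum (hX : IsPoissonProcess P X ρ)
    (h0 : intensityMeasure ρ Set.univ ≠ 0) (ht : intensityMeasure ρ Set.univ ≠ ⊤)
    (hg : Measurable (Function.uncurry g)) (a : S2) :
    ∫⁻ ω, pointSum g a (X ω) ∂P = ∫⁻ b, g a b ∂(intensityMeasure ρ) := by
  refine (hX.mecke h0 ht (φ := fun b _ => g a b) (hg.of_uncurry_left.comp measurable_fst)).trans ?_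
  simp

lemma IsPoissonProcess.lintegral_pairSum (hX : IsPoissonProcess P X ρ)
    (h0 : intensityMeasure ρ Set.univ ≠ 0) (ht : intensityMeasure ρ Set.univ ≠ ⊤)
    (hg : Measurable (Function.uncurry g)) :
    ∫⁻ ω, pairSum g (X ω) ∂P = ∫⁻ a, ∫⁻ b, g a b ∂(intensityMeasure ρ) ∂(intensityMeasure ρ) := by
  refine (hX.mecke h0 ht (φ := pointSum g) (measurable_pointSum hg)).trans ?_
  exact lintegral_congr fun a => hX.lintegral_pointSum h0 ht hg a

lemma IsPoissonProcess.lintegral_pointSum_sq (hX : IsPoissonProcess P X ρ)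
    (h0 : intensityMeasure ρ Set.univ ≠ 0) (ht : intensityMeasure ρ Set.univ ≠ ⊤)
    (hg : Measurable (Function.uncurry g)) (a : S2) :
    ∫⁻ ω, pointSum g a (X ω) * pointSum g a (X ω) ∂P =
      (∫⁻ b, g a b ∂(intensityMeasure ρ)) ^ 2 + ∫⁻ b, g a b ^ 2 ∂(intensityMeasure ρ) := by
  classical
  have hga : Measurable (g a) := hg.of_uncurry_left
  have hT : Measurable (pointSum g a) := (measurable_pointSum hg).of_uncurry_left
  have hTX : Measurable fun ω => pointSum g a (X ω) := hT.comp hX.measurable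
  have hdec : ∀ x : Finset S2, pointSum g a x * pointSum g a x =
      ∑ b ∈ x, g a b * (g a b + pointSum g a (x.erase b)) := by
    intro x
    rw [show pointSum g a x * pointSum g a x = (∑ b ∈ x, g a b) * pointSum g a x from rfl,
      Finset.sum_mul]
    exact Finset.sum_congr rfl fun b hb => by rw [← pointSum_of_mem a hb]
  simp_rw [hdec]
  refine (hX.mecke h0 ht (φ := fun b x => g a b * (g a b + pointSum g a x)) ?_).trans ?_
  · exact (hga.comp measurable_fst).mul ((hga.comp measurable_fst).add (hT.comp measurable_snd))
  · have : ∀ b, ∫⁻ ω, g a b * (g a b + pointSum g a (X ω)) ∂P =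
        g a b ^ 2 + g a b * ∫⁻ b, g a b ∂(intensityMeasure ρ) := by
      intro b
      rw [lintegral_const_mul _ (hTX.const_add _), lintegral_add_left measurable_const,
        hX.lintegral_pointSum h0 ht hg, lintegral_const, measure_univ]
      ring
    simp_rw [this]
    rw [lintegral_add_left (hga.pow_const 2), lintegral_mul_const _ hga]
    ring

/-- The mixed moment, by the Mecke formula for the sum `pointSum g a`: the point `b` that is removed
either does not occur in the pair sum or is one of its two points. -/
lemma IsPoissonProcess.lintegral_pointSum_mul_pairSum (hX : IsPoissonProcess P X ρ)
    (h0 : intensityMeasure ρ Set.univ ≠ 0) (ht : intensityMeasure ρ Set.univ ≠ ⊤)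
    (hg : Measurable (Function.uncurry g)) (hsym : ∀ a b, g a b = g b a) (a : S2) :
    ∫⁻ ω, pointSum g a (X ω) * pairSum g (X ω) ∂P =
      (∫⁻ b, g a b ∂(intensityMeasure ρ)) * ∫⁻ ω, pairSum g (X ω) ∂P +
        2 * ∫⁻ b, g a b * ∫⁻ c, g b c ∂(intensityMeasure ρ) ∂(intensityMeasure ρ) := by
  classical
  have : IsFiniteMeasure (intensityMeasure ρ) := ⟨ht.lt_top⟩
  have hga : Measurable (g a) := hg.of_uncurry_left
  have hS := measurable_pairSum hg
  have hG : Measurable fun b => ∫⁻ c, g b c ∂(intensityMeasure ρ) := hg.lintegral_prod_right'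
  have hdec : ∀ x : Finset S2, pointSum g a x * pairSum g x =
      ∑ b ∈ x, g a b * (pairSum g (x.erase b) + 2 * pointSum g b (x.erase b)) := by
    intro x
    rw [pointSum, Finset.sum_mul]
    exact Finset.sum_congr rfl fun b hb => by rw [← pairSum_of_mem hsym hb]
  simp_rw [hdec]
  refine (hX.mecke h0 ht (φ := fun b x => g a b * (pairSum g x + 2 * pointSum g b x)) ?_).trans ?_
  · exact (hga.comp measurable_fst).mul
      ((hS.comp measurable_snd).add ((measurable_pointSum hg).const_mul 2))
  · have : ∀ b, ∫⁻ ω, g a b * (pairSum g (X ω) + 2 * pointSum g b (X ω)) ∂P =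
        g a b * (∫⁻ ω, pairSum g (X ω) ∂P) + 2 * (g a b * ∫⁻ c, g b c ∂(intensityMeasure ρ)) := by
      intro b
      have hTb : Measurable fun ω => pointSum g b (X ω) :=
        (measurable_pointSum hg).of_uncurry_left.comp hX.measurable
      have hSX : Measurable fun ω => pairSum g (X ω) := hS.comp hX.measurable
      rw [lintegral_const_mul _ (by fun_prop), lintegral_add_left hSX,
        lintegral_const_mul _ hTb, hX.lintegral_pointSum h0 ht hg]
      ring
    simp_rw [this]
    rw [lintegral_add_left (hga.mul_const _), lintegral_mul_const _ hga,
      lintegral_const_mul _ (by fun_prop)]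

/-- The second moment of a sum over pairs: the three terms stem from two pairs that are disjoint,
that share one point, and that coincide. -/
lemma IsPoissonProcess.lintegral_pairSum_sq (hX : IsPoissonProcess P X ρ)
    (h0 : intensityMeasure ρ Set.univ ≠ 0) (ht : intensityMeasure ρ Set.univ ≠ ⊤)
    (hg : Measurable (Function.uncurry g)) (hsym : ∀ a b, g a b = g b a) :
    ∫⁻ ω, pairSum g (X ω) ^ 2 ∂P =
      (∫⁻ a, ∫⁻ b, g a b ∂(intensityMeasure ρ) ∂(intensityMeasure ρ)) ^ 2 +
        4 * (∫⁻ a, (∫⁻ b, g a b ∂(intensityMeasure ρ)) ^ 2 ∂(intensityMeasure ρ)) +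
        2 * ∫⁻ a, ∫⁻ b, g a b ^ 2 ∂(intensityMeasure ρ) ∂(intensityMeasure ρ) := by
  classical
  have : IsFiniteMeasure (intensityMeasure ρ) := ⟨ht.lt_top⟩
  have hS := measurable_pairSum hg
  have hT := measurable_pointSum hg
  have hG : Measurable fun b => ∫⁻ c, g b c ∂(intensityMeasure ρ) := hg.lintegral_prod_right'
  -- One factor is written as a sum over its first point `a`, and `a` is split off the other factor,
  -- so that the summand depends on `a` and on the pattern without `a`.
  have hdec : ∀ x : Finset S2, pairSum g x ^ 2 =
      ∑ a ∈ x, pointSum g a (x.erase a) *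
        (pairSum g (x.erase a) + 2 * pointSum g a (x.erase a)) := by
    intro x
    rw [sq]
    conv_lhs => rw [pairSum.eq_def g x]
    rw [Finset.sum_mul]
    exact Finset.sum_congr rfl fun a ha => by rw [← pairSum_of_mem hsym ha]; rfl
  simp_rw [hdec]
  refine (hX.mecke h0 ht (φ := fun a x => pointSum g a x * (pairSum g x + 2 * pointSum g a x))
    ?_).trans ?_
  · exact hT.mul ((hS.comp measurable_snd).add (hT.const_mul 2))
  · have : ∀ a, ∫⁻ ω, pointSum g a (X ω) * (pairSum g (X ω) + 2 * pointSum g a (X ω)) ∂P =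
        (∫⁻ b, g a b ∂(intensityMeasure ρ)) * (∫⁻ ω, pairSum g (X ω) ∂P) +
        (2 * (∫⁻ b, g a b * ∫⁻ c, g b c ∂(intensityMeasure ρ) ∂(intensityMeasure ρ)) +
        (2 * (∫⁻ b, g a b ∂(intensityMeasure ρ)) ^ 2 +
          2 * ∫⁻ b, g a b ^ 2 ∂(intensityMeasure ρ))) := by
      intro a
      have hTa : Measurable fun ω => pointSum g a (X ω) := hT.of_uncurry_left.comp hX.measurable
      have hSX : Measurable fun ω => pairSum g (X ω) := hS.comp hX.measurable
      have : ∀ ω, pointSum g a (X ω) * (pairSum g (X ω) + 2 * pointSum g a (X ω)) =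
          pointSum g a (X ω) * pairSum g (X ω) +
            2 * (pointSum g a (X ω) * pointSum g a (X ω)) := fun ω => by ring
      simp_rw [this]
      rw [lintegral_add_left (by fun_prop), lintegral_const_mul _ (by fun_prop),
        hX.lintegral_pointSum_sq h0 ht hg, hX.lintegral_pointSum_mul_pairSum h0 ht hg hsym]
      ring
    simp_rw [this]
    have hswap : ∫⁻ a, ∫⁻ b, g a b * ∫⁻ c, g b c ∂(intensityMeasure ρ) ∂(intensityMeasure ρ)
        ∂(intensityMeasure ρ) =
        ∫⁻ a, (∫⁻ b, g a b ∂(intensityMeasure ρ)) ^ 2 ∂(intensityMeasure ρ) := by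
      rw [lintegral_lintegral_swap]
      · refine lintegral_congr fun b => ?_
        simp_rw [hsym _ b]
        rw [lintegral_mul_const _ hg.of_uncurry_left, sq]
      · exact (hg.mul (hG.comp measurable_snd)).aemeasurable
    have hm2 : Measurable fun a => ∫⁻ b, g a b ^ 2 ∂(intensityMeasure ρ) :=
      (hg.pow_const 2).lintegral_prod_right'
    have hm1 : Measurable fun a => ∫⁻ b, g a b * ∫⁻ c, g b c ∂(intensityMeasure ρ)
        ∂(intensityMeasure ρ) :=
      (hg.mul (hG.comp measurable_snd)).lintegral_prod_right'
    rw [lintegral_add_left (hG.mul_const _), lintegral_add_left (hm1.const_mul 2),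
      lintegral_add_left ((hG.pow_const 2).const_mul 2), lintegral_mul_const _ hG,
      lintegral_const_mul _ hm1, lintegral_const_mul _ (hG.pow_const 2),
      lintegral_const_mul _ hm2, hswap,
      hX.lintegral_pairSum h0 ht hg]
    ring

end PairSums

/-! ### The estimator of the `K`-function -/

section K

variable {ρ : S2 → ℝ} {r : ℝ}

/-- The contribution of the pair `(a, b)` to the estimator of the `K`-function. -/
def kernelK (ρ : S2 → ℝ) (r : ℝ) (a b : S2) : ℝ :=
  (if geoDist a b ≤ r then 1 else 0) / (ρ a * ρ b)

lemma ind_cap (a b : S2) (r : ℝ) : ind (cap a r) b = if geoDist a b ≤ r then 1 else 0 := by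
  simp [ind, cap, Set.indicator_apply]

lemma measurable_ind_cap (r : ℝ) : Measurable fun z : S2 × S2 => ind (cap z.1 r) z.2 := by
  simp_rw [ind_cap]
  exact Measurable.ite (measurable_geoDist measurableSet_Iic) measurable_const measurable_const

lemma measurable_kernelK (hρ_meas : Measurable ρ) :
    Measurable (Function.uncurry (kernelK ρ r)) := by
  have h : Measurable fun z : S2 × S2 => (if geoDist z.1 z.2 ≤ r then (1 : ℝ) else 0) :=
    Measurable.ite (measurable_geoDist measurableSet_Iic) measurable_const measurable_const
  exact h.div ((hρ_meas.comp measurable_fst).mul (hρ_meas.comp measurable_snd))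

lemma kernelK_comm (a b : S2) : kernelK ρ r a b = kernelK ρ r b a := by
  rw [kernelK, kernelK, geoDist_comm, mul_comm]

lemma kernelK_nonneg (hρ_pos : 0 < infIntensity ρ) (a b : S2) : 0 ≤ kernelK ρ r a b := by
  have := pos_of_infIntensity_pos hρ_pos a
  have := pos_of_infIntensity_pos hρ_pos b
  unfold kernelK
  split_ifs <;> positivity

lemma integrable_kernelK (hρ_meas : Measurable ρ) (hρ_pos : 0 < infIntensity ρ) :
    Integrable (fun z : S2 × S2 => kernelK ρ r z.1 z.2) (area.prod area) := by
  refine (integrable_const (1 / (infIntensity ρ * infIntensity ρ))).mono'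
    (measurable_kernelK hρ_meas).aestronglyMeasurable (Eventually.of_forall fun z => ?_)
  rw [Real.norm_of_nonneg (kernelK_nonneg hρ_pos _ _), kernelK]
  have := pos_of_infIntensity_pos hρ_pos z.1
  have := infIntensity_le hρ_pos z.1
  have := infIntensity_le hρ_pos z.2
  gcongr
  split_ifs <;> norm_num

lemma area_cap_ofReal (hr : r ∈ Set.Icc 0 Real.pi) (o : S2) :
    area (cap o r) = ENNReal.ofReal (2 * Real.pi * (1 - Real.cos r)) := by
  rw [← area_cap hr o, ofReal_measureReal]

lemma lintegral_kernelK (hρ_meas : Measurable ρ) (hρ_pos : 0 < infIntensity ρ)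
    (hr : r ∈ Set.Icc 0 Real.pi) (a : S2) :
    ∫⁻ b, ENNReal.ofReal (kernelK ρ r a b) ∂(intensityMeasure ρ) =
      ENNReal.ofReal (2 * Real.pi * (1 - Real.cos r) / ρ a) := by
  have ha := pos_of_infIntensity_pos hρ_pos a
  rw [lintegral_intensityMeasure hρ_meas
    (measurable_kernelK hρ_meas).of_uncurry_left.ennreal_ofReal]
  have : ∀ b, ENNReal.ofReal (ρ b) * ENNReal.ofReal (kernelK ρ r a b) =
      (cap a r).indicator (fun _ => ENNReal.ofReal (1 / ρ a)) b := by
    intro b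
    have hb := pos_of_infIntensity_pos hρ_pos b
    rw [← ENNReal.ofReal_mul hb.le]
    by_cases h : geoDist a b ≤ r
    · rw [Set.indicator_of_mem (show b ∈ cap a r from h), kernelK, if_pos h]
      congr 1
      field_simp
    · rw [Set.indicator_of_notMem (show b ∉ cap a r from h), kernelK, if_neg h]
      simp
  simp_rw [this]
  rw [lintegral_indicator_const (measurableSet_cap a r), area_cap_ofReal hr,
    ← ENNReal.ofReal_mul (by positivity)]
  congr 1
  ring

lemma area_univ : area Set.univ = ENNReal.ofReal (4 * Real.pi) := by
  rw [← area_real_univ, ofReal_measureReal]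

variable {Ω : Type*} [MeasurableSpace Ω] {P : Measure Ω} [IsProbabilityMeasure P]
  {X : Ω → Finset S2}

lemma Khat_eq (hρ_pos : 0 < infIntensity ρ) (x : Finset S2) :
    Khat ρ r x = 1 / (4 * Real.pi) *
      (pairSum (fun a b => ENNReal.ofReal (kernelK ρ r a b)) x).toReal := by
  rw [Khat, pairSum]
  simp only [pointSum]
  rw [ENNReal.toReal_sum fun a _ => ENNReal.sum_ne_top.2 fun b _ => ENNReal.ofReal_ne_top]
  congr 1
  refine Finset.sum_congr rfl fun a _ => ?_
  rw [ENNReal.toReal_sum fun b _ => ENNReal.ofReal_ne_top]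
  exact Finset.sum_congr rfl fun b _ => (ENNReal.toReal_ofReal (kernelK_nonneg hρ_pos a b)).symm

lemma variance_Khat (hρ_meas : Measurable ρ) (hρ_int : Integrable ρ area)
    (hρ_pos : 0 < infIntensity ρ) (hX : IsPoissonProcess P X ρ) (hr : r ∈ Set.Icc 0 Real.pi) :
    MemLp (fun ω => Khat ρ r (X ω)) 2 P ∧
      variance (fun ω => Khat ρ r (X ω)) P =
        1 / (8 * Real.pi ^ 2) * (∫ y, ∫ x, kernelK ρ r x y ∂area ∂area)
        + (1 - Real.cos r) ^ 2 * ∫ x, 1 / ρ x ∂area := by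
  have h0 := intensityMeasure_univ_ne_zero hρ_int hρ_pos
  have ht := intensityMeasure_univ_ne_top hρ_int hρ_pos
  set κ := 2 * Real.pi * (1 - Real.cos r) with hκ
  have hκ0 : 0 ≤ κ := mul_nonneg (by positivity) (by linarith [Real.cos_le_one r])
  set J := ∫ x, 1 / ρ x ∂area with hJ
  have hJ0 : 0 ≤ J := integral_nonneg fun x => by
    have := pos_of_infIntensity_pos hρ_pos x
    positivity
  set I := ∫ y, ∫ x, kernelK ρ r x y ∂area ∂area with hI
  have hI0 : 0 ≤ I := integral_nonneg fun y => integral_nonneg fun x => kernelK_nonneg hρ_pos x y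
  have hg : Measurable (Function.uncurry fun a b => ENNReal.ofReal (kernelK ρ r a b)) :=
    (measurable_kernelK hρ_meas).ennreal_ofReal
  have hG := lintegral_kernelK hρ_meas hρ_pos hr
  have hmG : Measurable fun a => ENNReal.ofReal (κ / ρ a) :=
    (measurable_const.div hρ_meas).ennreal_ofReal
  have hmean : ∫⁻ a, ∫⁻ b, ENNReal.ofReal (kernelK ρ r a b) ∂(intensityMeasure ρ)
      ∂(intensityMeasure ρ) = ENNReal.ofReal (4 * Real.pi * κ) := by
    simp_rw [hG]
    rw [lintegral_intensityMeasure hρ_meas hmG]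
    have : ∀ a, ENNReal.ofReal (ρ a) * ENNReal.ofReal (κ / ρ a) = ENNReal.ofReal κ := by
      intro a
      have ha := pos_of_infIntensity_pos hρ_pos a
      rw [← ENNReal.ofReal_mul ha.le, mul_div_cancel₀ _ ha.ne']
    simp_rw [this]
    rw [lintegral_const, area_univ, ← ENNReal.ofReal_mul hκ0, mul_comm]
  have hsq1 : ∫⁻ a, (∫⁻ b, ENNReal.ofReal (kernelK ρ r a b) ∂(intensityMeasure ρ)) ^ 2
      ∂(intensityMeasure ρ) = ENNReal.ofReal (κ ^ 2 * J) := by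
    simp_rw [hG]
    rw [lintegral_intensityMeasure hρ_meas (hmG.pow_const 2), hJ, ← integral_const_mul,
      ofReal_integral_eq_lintegral_ofReal ((integrable_one_div hρ_meas hρ_pos).const_mul _)]
    · refine lintegral_congr fun a => ?_
      have ha := pos_of_infIntensity_pos hρ_pos a
      rw [← ENNReal.ofReal_pow (by positivity), ← ENNReal.ofReal_mul ha.le]
      congr 1
      field_simp
    · refine Eventually.of_forall fun a => ?_
      have ha := pos_of_infIntensity_pos hρ_pos a
      simp only [Pi.zero_apply]
      positivity
  have hsq2 : ∫⁻ a, ∫⁻ b, ENNReal.ofReal (kernelK ρ r a b) ^ 2 ∂(intensityMeasure ρ)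
      ∂(intensityMeasure ρ) = ENNReal.ofReal I := by
    have := isFiniteMeasure_intensityMeasure hρ_int hρ_pos
    have hm2 : Measurable fun a =>
        ∫⁻ b, ENNReal.ofReal (kernelK ρ r a b) ^ 2 ∂(intensityMeasure ρ) :=
      (hg.pow_const 2).lintegral_prod_right'
    have hI' : I = ∫ z : S2 × S2, kernelK ρ r z.1 z.2 ∂(area.prod area) :=
      (integral_prod_symm _ (integrable_kernelK hρ_meas hρ_pos)).symm
    rw [hI', ofReal_integral_eq_lintegral_ofReal (integrable_kernelK hρ_meas hρ_pos)
      (Eventually.of_forall fun z => kernelK_nonneg hρ_pos _ _),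
      lintegral_prod (fun z : S2 × S2 => ENNReal.ofReal (kernelK ρ r z.1 z.2)) hg.aemeasurable,
      lintegral_intensityMeasure hρ_meas hm2]
    refine lintegral_congr fun a => ?_
    have hma : Measurable fun b => ENNReal.ofReal (kernelK ρ r a b) := hg.of_uncurry_left
    rw [lintegral_intensityMeasure hρ_meas (hma.pow_const 2), ← lintegral_const_mul _
      (by fun_prop)]
    refine lintegral_congr fun b => ?_
    have ha := pos_of_infIntensity_pos hρ_pos a
    have hb := pos_of_infIntensity_pos hρ_pos b
    rw [← ENNReal.ofReal_pow (kernelK_nonneg hρ_pos a b), ← ENNReal.ofReal_mul hb.le,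
      ← ENNReal.ofReal_mul ha.le]
    congr 1
    unfold kernelK
    split_ifs
    · field_simp
    · simp
  have hm1 := hX.lintegral_pairSum h0 ht hg
  have hm2 := hX.lintegral_pairSum_sq h0 ht hg fun a b => by simp only [kernelK_comm a b]
  rw [hmean] at hm1
  rw [hmean, hsq1, hsq2, ← ENNReal.ofReal_pow (by positivity),
    show (4 : ℝ≥0∞) = ENNReal.ofReal 4 by simp, show (2 : ℝ≥0∞) = ENNReal.ofReal 2 by simp,
    ← ENNReal.ofReal_mul (by norm_num), ← ENNReal.ofReal_mul (by norm_num),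
    ← ENNReal.ofReal_add (by positivity) (by positivity),
    ← ENNReal.ofReal_add (by positivity) (by positivity)] at hm2
  have hvar := variance_toReal ((measurable_pairSum hg).comp hX.measurable)
    (by positivity) (by positivity) hm1 hm2
  simp_rw [Khat_eq hρ_pos]
  refine ⟨hvar.1.const_mul _, ?_⟩
  rw [variance_const_mul]
  refine (congrArg _ hvar.2).trans ?_
  rw [hκ]
  have := Real.pi_pos
  field_simp
  ring

end K

/-! ### The thinning factors -/

section Thinning

variable {ρ : S2 → ℝ} {r : ℝ}

/-- The factor that the point `b` contributes to the products over the cap around `a` in the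
estimators of the `F`- and `H`-functions; it is `1` outside the cap. -/
def capFactor (ρ : S2 → ℝ) (r : ℝ) (a b : S2) : ℝ :=
  1 - infIntensity ρ * ind (cap a r) b / ρ b

lemma capFactor_of_mem {a b : S2} (h : b ∈ cap a r) :
    capFactor ρ r a b = 1 - infIntensity ρ / ρ b := by
  simp [capFactor, ind, h]

lemma capFactor_of_notMem {a b : S2} (h : b ∉ cap a r) : capFactor ρ r a b = 1 := by
  simp [capFactor, ind, h]

lemma capFactor_nonneg (hρ_pos : 0 < infIntensity ρ) (a b : S2) : 0 ≤ capFactor ρ r a b := by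
  by_cases h : b ∈ cap a r
  · rw [capFactor_of_mem h, sub_nonneg, div_le_one (pos_of_infIntensity_pos hρ_pos b)]
    exact infIntensity_le hρ_pos b
  · rw [capFactor_of_notMem h]; exact zero_le_one

lemma capFactor_le_one (hρ_pos : 0 < infIntensity ρ) (a b : S2) : capFactor ρ r a b ≤ 1 := by
  by_cases h : b ∈ cap a r
  · rw [capFactor_of_mem h]
    have := pos_of_infIntensity_pos hρ_pos b
    have : 0 < infIntensity ρ / ρ b := by positivity
    linarith
  · rw [capFactor_of_notMem h]

lemma measurable_capFactor (hρ_meas : Measurable ρ) :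
    Measurable (Function.uncurry (capFactor ρ r)) :=
  measurable_const.sub (((measurable_ind_cap r).const_mul _).div (hρ_meas.comp measurable_snd))

lemma mul_capFactor (hρ_pos : 0 < infIntensity ρ) (a b : S2) :
    ρ b * capFactor ρ r a b = ρ b - infIntensity ρ * ind (cap a r) b := by
  have := pos_of_infIntensity_pos hρ_pos b
  rw [capFactor]
  field_simp

lemma integrable_ind {B : Set S2} (hB : MeasurableSet B) : Integrable (ind B) area :=
  (integrable_const (1 : ℝ)).indicator hB

lemma integral_ind_cap (hr : r ∈ Set.Icc 0 Real.pi) (a : S2) :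
    ∫ b, ind (cap a r) b ∂area = 2 * Real.pi * (1 - Real.cos r) := by
  rw [← area_cap hr a]
  exact integral_indicator_one (measurableSet_cap a r)

lemma integrable_mul_capFactor (hρ_int : Integrable ρ area) (hρ_pos : 0 < infIntensity ρ)
    (a : S2) : Integrable (fun b => ρ b * capFactor ρ r a b) area := by
  simp_rw [mul_capFactor hρ_pos]
  exact hρ_int.sub ((integrable_ind (measurableSet_cap a r)).const_mul _)

lemma integral_mul_capFactor (hρ_int : Integrable ρ area) (hρ_pos : 0 < infIntensity ρ)
    (hr : r ∈ Set.Icc 0 Real.pi) (a : S2) :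
    (∫ b, ρ b * capFactor ρ r a b ∂area) / totalMass ρ = Cconst ρ r := by
  have hΛ := totalMass_pos hρ_int hρ_pos
  simp_rw [mul_capFactor hρ_pos]
  rw [integral_sub hρ_int ((integrable_ind (measurableSet_cap a r)).const_mul _),
    integral_const_mul, integral_ind_cap hr, Cconst]
  change (totalMass ρ - _) / totalMass ρ = _
  field_simp

lemma mul_capFactor_mul (hρ_pos : 0 < infIntensity ρ) (a c b : S2) :
    ρ b * (capFactor ρ r a b * capFactor ρ r c b) =
      ρ b - infIntensity ρ * ind (cap a r) b - infIntensity ρ * ind (cap c r) b +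
        infIntensity ρ ^ 2 * (cap a r ∩ cap c r).indicator (fun z => 1 / ρ z) b := by
  have := pos_of_infIntensity_pos hρ_pos b
  by_cases ha : b ∈ cap a r <;> by_cases hc : b ∈ cap c r <;>
    simp [capFactor, ind, ha, hc] <;> field_simp
  all_goals ring

lemma integrable_mul_capFactor_mul (hρ_meas : Measurable ρ) (hρ_int : Integrable ρ area)
    (hρ_pos : 0 < infIntensity ρ) (a c : S2) :
    Integrable (fun b => ρ b * (capFactor ρ r a b * capFactor ρ r c b)) area := by
  simp_rw [mul_capFactor_mul hρ_pos]
  exact ((hρ_int.sub ((integrable_ind (measurableSet_cap a r)).const_mul _)).sub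
    ((integrable_ind (measurableSet_cap c r)).const_mul _)).add
    (((integrable_one_div hρ_meas hρ_pos).indicator
      ((measurableSet_cap a r).inter (measurableSet_cap c r))).const_mul _)

lemma integral_mul_capFactor_mul (hρ_meas : Measurable ρ) (hρ_int : Integrable ρ area)
    (hρ_pos : 0 < infIntensity ρ) (hr : r ∈ Set.Icc 0 Real.pi) (a c : S2) :
    (∫ b, ρ b * (capFactor ρ r a b * capFactor ρ r c b) ∂area) / totalMass ρ = A1 ρ r a c := by
  have hΛ := totalMass_pos hρ_int hρ_pos
  have h1 := (integrable_ind (measurableSet_cap a r)).const_mul (infIntensity ρ)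
  have h2 := (integrable_ind (measurableSet_cap c r)).const_mul (infIntensity ρ)
  have hB := (measurableSet_cap a r).inter (measurableSet_cap c r)
  have h12 : Integrable (fun b => ρ b - infIntensity ρ * ind (cap a r) b -
      infIntensity ρ * ind (cap c r) b) area := (hρ_int.sub h1).sub h2
  have h11 : Integrable (fun b => ρ b - infIntensity ρ * ind (cap a r) b) area := hρ_int.sub h1
  simp_rw [mul_capFactor_mul hρ_pos]
  rw [integral_add h12
      (((integrable_one_div hρ_meas hρ_pos).indicator hB).const_mul _),
    integral_sub h11 h2, integral_sub hρ_int h1]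
  simp only [integral_const_mul]
  rw [integral_ind_cap hr, integral_ind_cap hr, integral_indicator hB, A1]
  change (totalMass ρ - _ - _ + _) / totalMass ρ = _
  field_simp
  ring

lemma A1_nonneg (hρ_meas : Measurable ρ) (hρ_int : Integrable ρ area)
    (hρ_pos : 0 < infIntensity ρ) (hr : r ∈ Set.Icc 0 Real.pi) (a c : S2) : 0 ≤ A1 ρ r a c := by
  rw [← integral_mul_capFactor_mul hρ_meas hρ_int hρ_pos hr]
  exact div_nonneg (integral_nonneg fun b => mul_nonneg (pos_of_infIntensity_pos hρ_pos b).le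
    (mul_nonneg (capFactor_nonneg hρ_pos a b) (capFactor_nonneg hρ_pos c b)))
    (totalMass_pos hρ_int hρ_pos).le

lemma A2_eq (a : S2) : A2 ρ r a = A1 ρ r a a := by
  rw [A1, A2, Set.inter_self]

lemma Cconst_nonneg (hρ_int : Integrable ρ area)
    (hρ_pos : 0 < infIntensity ρ) (hr : r ∈ Set.Icc 0 Real.pi) : 0 ≤ Cconst ρ r := by
  obtain ⟨a⟩ := nonempty_S2
  rw [← integral_mul_capFactor hρ_int hρ_pos hr a]
  exact div_nonneg (integral_nonneg fun b => mul_nonneg (pos_of_infIntensity_pos hρ_pos b).le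
    (capFactor_nonneg hρ_pos a b)) (totalMass_pos hρ_int hρ_pos).le

/-- If `A₂` vanishes somewhere, then almost every point lies in the cap and has the minimal
intensity. -/
lemma A2_pos (hρ_meas : Measurable ρ) (hρ_int : Integrable ρ area)
    (hρ_pos : 0 < infIntensity ρ) (hr : r ∈ Set.Icc 0 Real.pi)
    (h : r < Real.pi ∨ ¬ ∀ᵐ x ∂area, ρ x = infIntensity ρ) (a : S2) : 0 < A2 ρ r a := by
  rw [A2_eq]
  refine (A1_nonneg hρ_meas hρ_int hρ_pos hr a a).lt_of_ne' fun h0 => ?_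
  rw [← integral_mul_capFactor_mul hρ_meas hρ_int hρ_pos hr, div_eq_zero_iff,
    or_iff_left (totalMass_pos hρ_int hρ_pos).ne', integral_eq_zero_iff_of_nonneg
      (fun b => mul_nonneg (pos_of_infIntensity_pos hρ_pos b).le (mul_self_nonneg _))
      (integrable_mul_capFactor_mul hρ_meas hρ_int hρ_pos a a)] at h0
  have hae : ∀ᵐ b ∂area, b ∈ cap a r ∧ ρ b = infIntensity ρ := by
    filter_upwards [h0] with b hb
    have hb' := pos_of_infIntensity_pos hρ_pos b
    have hz : capFactor ρ r a b = 0 := by simpa [hb'.ne'] using hb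
    by_cases hm : b ∈ cap a r
    · rw [capFactor_of_mem hm, sub_eq_zero, eq_div_iff hb'.ne', one_mul] at hz
      exact ⟨hm, hz⟩
    · rw [capFactor_of_notMem hm] at hz
      exact absurd hz one_ne_zero
  rcases h with h | h
  · have h1 : area.real (cap a r) = area.real Set.univ :=
      measureReal_congr (by
        filter_upwards [hae] with b hb
        exact propext ⟨fun _ => trivial, fun _ => hb.1⟩)
    rw [area_cap hr, area_real_univ] at h1
    have h2 : Real.cos Real.pi < Real.cos r := Real.cos_lt_cos_of_nonneg_of_le_pi hr.1 le_rfl h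
    rw [Real.cos_pi] at h2
    nlinarith [Real.pi_pos]
  · exact h (hae.mono fun b hb => hb.2)

lemma Cconst_pos (hρ_meas : Measurable ρ) (hρ_int : Integrable ρ area)
    (hρ_pos : 0 < infIntensity ρ) (hr : r ∈ Set.Icc 0 Real.pi)
    (h : r < Real.pi ∨ ¬ ∀ᵐ x ∂area, ρ x = infIntensity ρ) : 0 < Cconst ρ r := by
  obtain ⟨a⟩ := nonempty_S2
  refine (A2_pos hρ_meas hρ_int hρ_pos hr h a).trans_le ?_
  rw [A2_eq, ← integral_mul_capFactor_mul hρ_meas hρ_int hρ_pos hr,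
    ← integral_mul_capFactor hρ_int hρ_pos hr a]
  refine div_le_div_of_nonneg_right (integral_mono
    (integrable_mul_capFactor_mul hρ_meas hρ_int hρ_pos a a)
    (integrable_mul_capFactor hρ_int hρ_pos a) fun b => ?_) (totalMass_pos hρ_int hρ_pos).le
  exact mul_le_mul_of_nonneg_left
    (mul_le_of_le_one_left (capFactor_nonneg hρ_pos a b) (capFactor_le_one hρ_pos a b))
    (pos_of_infIntensity_pos hρ_pos b).le

lemma lintegral_capFactor (hρ_meas : Measurable ρ) (hρ_int : Integrable ρ area)
    (hρ_pos : 0 < infIntensity ρ) (hr : r ∈ Set.Icc 0 Real.pi) (a : S2) :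
    ∫⁻ b, ENNReal.ofReal (capFactor ρ r a b) ∂(pointLaw ρ) = ENNReal.ofReal (Cconst ρ r) := by
  rw [lintegral_pointLaw hρ_meas hρ_int hρ_pos (measurable_capFactor hρ_meas).of_uncurry_left
    (capFactor_nonneg hρ_pos a) (integrable_mul_capFactor hρ_int hρ_pos a),
    integral_mul_capFactor hρ_int hρ_pos hr]

lemma lintegral_capFactor_mul (hρ_meas : Measurable ρ) (hρ_int : Integrable ρ area)
    (hρ_pos : 0 < infIntensity ρ) (hr : r ∈ Set.Icc 0 Real.pi) (a c : S2) :
    ∫⁻ b, ENNReal.ofReal (capFactor ρ r a b) * ENNReal.ofReal (capFactor ρ r c b) ∂(pointLaw ρ) =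
      ENNReal.ofReal (A1 ρ r a c) := by
  simp_rw [← ENNReal.ofReal_mul (capFactor_nonneg hρ_pos a _)]
  have hm := measurable_capFactor (r := r) hρ_meas
  have hm' : Measurable fun b => capFactor ρ r a b * capFactor ρ r c b :=
    hm.of_uncurry_left.mul hm.of_uncurry_left
  rw [lintegral_pointLaw hρ_meas hρ_int hρ_pos hm'
    (fun b => mul_nonneg (capFactor_nonneg hρ_pos a b) (capFactor_nonneg hρ_pos c b))
    (integrable_mul_capFactor_mul hρ_meas hρ_int hρ_pos a c),
    integral_mul_capFactor_mul hρ_meas hρ_int hρ_pos hr]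

end Thinning

/-! ### Poisson averages of powers -/

section Poisson

variable {Ω : Type*} [MeasurableSpace Ω] {P : Measure Ω} [IsProbabilityMeasure P]
  {X : Ω → Finset S2} {ρ : S2 → ℝ}

/-- The transfer of a real power series to extended nonnegative reals. -/
lemma tsum_poissonWeight (hρ_int : Integrable ρ area) (hρ_pos : 0 < infIntensity ρ)
    {g : ℕ → ℝ} (hg : ∀ n, 0 ≤ g n) {A s : ℝ} (hA : 0 ≤ A)
    (h : HasSum (fun n : ℕ => Real.exp (-totalMass ρ) * totalMass ρ ^ n / n.factorial *
      (g n * A ^ n)) s) :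
    ∑' n, poissonWeight ρ n * (ENNReal.ofReal (g n) * ENNReal.ofReal A ^ n) =
      ENNReal.ofReal s := by
  have hΛ := totalMass_pos hρ_int hρ_pos
  have hn : ∀ n, 0 ≤ Real.exp (-totalMass ρ) * totalMass ρ ^ n / n.factorial * (g n * A ^ n) :=
    fun n => mul_nonneg (by positivity) (mul_nonneg (hg n) (pow_nonneg hA n))
  rw [← h.tsum_eq, ENNReal.ofReal_tsum_of_nonneg hn h.summable]
  refine tsum_congr fun n => ?_
  rw [poissonWeight_eq hρ_int hρ_pos, ← ENNReal.ofReal_pow hA, ← ENNReal.ofReal_mul (hg n),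
    ← ENNReal.ofReal_mul (by positivity)]

lemma hasSum_exp_poisson (m A : ℝ) :
    HasSum (fun n : ℕ => Real.exp (-m) * m ^ n / n.factorial * (1 * A ^ n))
      (Real.exp (-m + m * A)) := by
  have h := (NormedSpace.expSeries_div_hasSum_exp (𝔸 := ℝ) (m * A)).mul_left (Real.exp (-m))
  rw [← Real.exp_eq_exp_ℝ, ← Real.exp_add] at h
  refine h.congr_fun fun n => ?_
  rw [mul_pow]
  ring

lemma mem_Icc_of_hasSum_poisson {m A s : ℝ} (hm : 0 < m) (hA : A ∈ Set.Icc (0 : ℝ) 1)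
    {g : ℕ → ℝ} (hg : ∀ n, g n ∈ Set.Icc (0 : ℝ) 1)
    (h : HasSum (fun n : ℕ => Real.exp (-m) * m ^ n / n.factorial * (g n * A ^ n)) s) :
    s ∈ Set.Icc (0 : ℝ) 1 := by
  refine ⟨h.nonneg fun n => mul_nonneg (by positivity)
    (mul_nonneg (hg n).1 (pow_nonneg hA.1 n)), ?_⟩
  have h1 := hasSum_exp_poisson m 1
  rw [mul_one, neg_add_cancel, Real.exp_zero] at h1
  refine hasSum_le (fun n => mul_le_mul_of_nonneg_left ?_ (by positivity)) h h1
  rw [one_pow, mul_one]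
  exact mul_le_one₀ (hg n).2 (pow_nonneg hA.1 n) (pow_le_one₀ hA.1 hA.2)

/-- The probability generating functional of a Poisson process. -/
lemma IsPoissonProcess.lintegral_prod_eq_exp (hρ_int : Integrable ρ area)
    (hρ_pos : 0 < infIntensity ρ) (hX : IsPoissonProcess P X ρ)
    {h : S2 → ℝ≥0∞} (hh : Measurable h) {c : ℝ} (hc : 0 ≤ c)
    (hc' : ∫⁻ b, h b ∂(pointLaw ρ) = ENNReal.ofReal c) :
    ∫⁻ ω, ∏ b ∈ X ω, h b ∂P = ENNReal.ofReal (Real.exp (-totalMass ρ + totalMass ρ * c)) := by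
  have := hX.lintegral_card_mul_prod (intensityMeasure_univ_ne_zero hρ_int hρ_pos)
    (intensityMeasure_univ_ne_top hρ_int hρ_pos) (fun _ => 1) hh
  simp only [one_mul] at this
  rw [this, hc', ← tsum_poissonWeight hρ_int hρ_pos (fun _ => zero_le_one) hc
    (hasSum_exp_poisson _ c)]
  simp

end Poisson

/-! ### The estimator of the `F`-function -/

section F

variable {Ω : Type*} [MeasurableSpace Ω] {P : Measure Ω} [IsProbabilityMeasure P]
  {X : Ω → Finset S2} {ρ : S2 → ℝ} {r : ℝ}

lemma prod_restrictTo_cap (p : S2) (x : Finset S2) :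
    ∏ a ∈ restrictTo (cap p r) x, (1 - infIntensity ρ / ρ a) = ∏ a ∈ x, capFactor ρ r p a := by
  classical
  rw [restrictTo, Finset.prod_filter]
  refine Finset.prod_congr rfl fun a _ => ?_
  split_ifs with h
  · rw [capFactor_of_mem h]
  · rw [capFactor_of_notMem h]

lemma Fhat_eq (hρ_pos : 0 < infIntensity ρ) (G x : Finset S2) :
    Fhat ρ G r x = 1 - 1 / (G.card : ℝ) *
      (∑ p ∈ G, ∏ a ∈ x, ENNReal.ofReal (capFactor ρ r p a)).toReal := by
  have h : ∀ p ∈ G, ∏ a ∈ x, ENNReal.ofReal (capFactor ρ r p a) =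
      ENNReal.ofReal (∏ a ∈ x, capFactor ρ r p a) := fun p _ =>
    (ENNReal.ofReal_prod_of_nonneg fun a _ => capFactor_nonneg hρ_pos p a).symm
  rw [Finset.sum_congr rfl h, ENNReal.toReal_sum fun _ _ => ENNReal.ofReal_ne_top, Fhat,
    div_eq_inv_mul, one_div]
  congr 2
  refine Finset.sum_congr rfl fun p _ => ?_
  rw [prod_restrictTo_cap, ENNReal.toReal_ofReal
    (Finset.prod_nonneg fun a _ => capFactor_nonneg hρ_pos p a)]

lemma variance_Fhat (hρ_meas : Measurable ρ) (hρ_int : Integrable ρ area)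
    (hρ_pos : 0 < infIntensity ρ) (hX : IsPoissonProcess P X ρ) (hr : r ∈ Set.Icc 0 Real.pi)
    {G : Finset S2} (hG : G.Nonempty) :
    MemLp (fun ω => Fhat ρ G r (X ω)) 2 P ∧
      ∀ o : S2, variance (fun ω => Fhat ρ G r (X ω)) P =
        Real.exp (-2 * infIntensity ρ * area.real (cap o r)) / (G.card : ℝ) ^ 2 *
          (∑ p ∈ G, ∑ p' ∈ G,
            Real.exp (∫ x in cap p r ∩ cap p' r, infIntensity ρ ^ 2 / ρ x ∂area))
        - Real.exp (-2 * infIntensity ρ * area.real (cap o r)) := by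
  have hΛ := totalMass_pos hρ_int hρ_pos
  set κ := 2 * Real.pi * (1 - Real.cos r) with hκ
  have hm : ∀ p, Measurable fun b => ENNReal.ofReal (capFactor ρ r p b) := fun p =>
    (measurable_capFactor hρ_meas).of_uncurry_left.ennreal_ofReal
  have hmprod : ∀ p, Measurable fun ω => ∏ a ∈ X ω, ENNReal.ofReal (capFactor ρ r p a) :=
    fun p => (measurable_prod_pattern' (hm p)).comp hX.measurable
  have h1 : ∀ p, ∫⁻ ω, ∏ a ∈ X ω, ENNReal.ofReal (capFactor ρ r p a) ∂P =
      ENNReal.ofReal (Real.exp (-(infIntensity ρ * κ))) := by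
    intro p
    rw [hX.lintegral_prod_eq_exp hρ_int hρ_pos (hm p) (Cconst_nonneg hρ_int hρ_pos hr)
      (lintegral_capFactor hρ_meas hρ_int hρ_pos hr p), Cconst]
    congr 2
    field_simp
    rw [hκ]
    ring
  have h2 : ∀ p q, ∫⁻ ω, (∏ a ∈ X ω, ENNReal.ofReal (capFactor ρ r p a)) *
      (∏ a ∈ X ω, ENNReal.ofReal (capFactor ρ r q a)) ∂P =
      ENNReal.ofReal (Real.exp (-2 * infIntensity ρ * κ) *
        Real.exp (∫ x in cap p r ∩ cap q r, infIntensity ρ ^ 2 / ρ x ∂area)) := by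
    intro p q
    simp_rw [← Finset.prod_mul_distrib]
    have hmm : Measurable fun b => ENNReal.ofReal (capFactor ρ r p b) *
        ENNReal.ofReal (capFactor ρ r q b) := (hm p).mul (hm q)
    rw [hX.lintegral_prod_eq_exp hρ_int hρ_pos hmm
      (A1_nonneg hρ_meas hρ_int hρ_pos hr p q)
      (lintegral_capFactor_mul hρ_meas hρ_int hρ_pos hr p q), A1, ← Real.exp_add]
    congr 2
    have h3 : ∫ x in cap p r ∩ cap q r, infIntensity ρ ^ 2 / ρ x ∂area =
        infIntensity ρ ^ 2 * ∫ x in cap p r ∩ cap q r, 1 / ρ x ∂area := by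
      rw [← integral_const_mul]
      simp_rw [mul_one_div]
    rw [h3]
    field_simp
    rw [hκ]
    ring
  have hE1 : ∫⁻ ω, ∑ p ∈ G, ∏ a ∈ X ω, ENNReal.ofReal (capFactor ρ r p a) ∂P =
      ENNReal.ofReal (G.card * Real.exp (-(infIntensity ρ * κ))) := by
    rw [lintegral_finsetSum _ fun p _ => hmprod p, Finset.sum_congr rfl fun p _ => h1 p,
      Finset.sum_const, ENNReal.ofReal_mul (by positivity), ENNReal.ofReal_natCast, nsmul_eq_mul]
  have hE2 : ∫⁻ ω, (∑ p ∈ G, ∏ a ∈ X ω, ENNReal.ofReal (capFactor ρ r p a)) ^ 2 ∂P =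
      ENNReal.ofReal (Real.exp (-2 * infIntensity ρ * κ) * ∑ p ∈ G, ∑ q ∈ G,
        Real.exp (∫ x in cap p r ∩ cap q r, infIntensity ρ ^ 2 / ρ x ∂area)) := by
    have hmm : ∀ p q, Measurable fun ω => (∏ a ∈ X ω, ENNReal.ofReal (capFactor ρ r p a)) *
        ∏ a ∈ X ω, ENNReal.ofReal (capFactor ρ r q a) := fun p q => (hmprod p).mul (hmprod q)
    have hsq : ∀ ω, (∑ p ∈ G, ∏ a ∈ X ω, ENNReal.ofReal (capFactor ρ r p a)) ^ 2 =
        ∑ p ∈ G, ∑ q ∈ G, (∏ a ∈ X ω, ENNReal.ofReal (capFactor ρ r p a)) *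
          ∏ a ∈ X ω, ENNReal.ofReal (capFactor ρ r q a) := fun ω => by
      rw [sq, Finset.sum_mul_sum]
    simp_rw [hsq]
    rw [lintegral_finsetSum _ fun p _ => Finset.measurable_sum _ fun q _ => hmm p q]
    rw [Finset.mul_sum, ENNReal.ofReal_sum_of_nonneg fun p _ => by positivity]
    refine Finset.sum_congr rfl fun p _ => ?_
    rw [lintegral_finsetSum _ fun q _ => hmm p q,
      Finset.mul_sum, ENNReal.ofReal_sum_of_nonneg fun p _ => by positivity]
    exact Finset.sum_congr rfl fun q _ => h2 p q
  have hvar := variance_toReal (Finset.measurable_sum _ fun p _ => hmprod p) (by positivity)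
    (by positivity) hE1 hE2
  have hcard : (G.card : ℝ) ≠ 0 := by simpa using hG.ne_empty
  simp_rw [Fhat_eq hρ_pos]
  refine ⟨(memLp_const 1).sub (hvar.1.const_mul _), fun o => ?_⟩
  rw [variance_const_sub (hvar.1.const_mul _).aestronglyMeasurable, variance_const_mul, hvar.2,
    area_cap hr, ← hκ, mul_pow, ← Real.exp_nat_mul]
  have h4 : ((2 : ℕ) : ℝ) * -(infIntensity ρ * κ) = -2 * infIntensity ρ * κ := by
    push_cast; ring
  rw [h4]
  field_simp

end F

/-! ### The estimator of the `H`-function -/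

section AverageOfProducts

/-- The product of the factors `h a b` over the points `b` of a pattern. -/
def pointProd (h : S2 → S2 → ℝ≥0∞) (a : S2) (x : Finset S2) : ℝ≥0∞ := ∏ b ∈ x, h a b

/-- The weight `1 / n`, with the value `0` for `n = 0`. -/
def invCard (n : ℕ) : ℝ≥0∞ := ENNReal.ofReal (1 / (n : ℝ))

open scoped Classical in
/-- The average over the points `a` of a pattern of the products of `h a b` over the other points
`b`; it is `0` for the empty pattern. -/
def averageProd (h : S2 → S2 → ℝ≥0∞) (x : Finset S2) : ℝ≥0∞ :=
  invCard x.card * ∑ a ∈ x, pointProd h a (x.erase a)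

variable {h : S2 → S2 → ℝ≥0∞}

lemma measurable_pointProd (hh : Measurable (Function.uncurry h)) :
    Measurable (Function.uncurry (pointProd h)) :=
  measurable_prod_pattern hh

lemma measurable_invCard_card (k : ℕ) : Measurable fun x : Finset S2 => invCard (x.card + k) :=
  (measurable_of_countable fun n => invCard (n + k)).comp measurable_card

lemma measurable_averageProd (hh : Measurable (Function.uncurry h)) :
    Measurable (averageProd h) :=
  (measurable_invCard_card 0).mul (measurable_sum_erase_pattern' (measurable_pointProd hh))

open scoped Classical in
lemma pointProd_of_mem (c : S2) {a : S2} {x : Finset S2} (ha : a ∈ x) :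
    pointProd h c x = h c a * pointProd h c (x.erase a) :=
  (Finset.mul_prod_erase x (h c) ha).symm

open scoped Classical in
/-- The average with the point `a` split off, once as the centre and once as a factor. -/
lemma averageProd_of_mem {a : S2} {x : Finset S2} (ha : a ∈ x) :
    averageProd h x = invCard ((x.erase a).card + 1) * (pointProd h a (x.erase a) +
      ∑ c ∈ x.erase a, h c a * pointProd h c ((x.erase a).erase c)) := by
  rw [averageProd, Finset.card_erase_add_one ha, ← Finset.add_sum_erase x _ ha]
  congr 2
  refine Finset.sum_congr rfl fun c hc => ?_
  have hac : a ∈ x.erase c := Finset.mem_erase.2 ⟨(Finset.ne_of_mem_erase hc).symm, ha⟩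
  rw [pointProd_of_mem c hac, Finset.erase_right_comm]

variable {Ω : Type*} [MeasurableSpace Ω] {P : Measure Ω} [IsProbabilityMeasure P]
  {X : Ω → Finset S2} {ρ : S2 → ℝ}

lemma IsPoissonProcess.lintegral_averageProd (hX : IsPoissonProcess P X ρ)
    (h0 : intensityMeasure ρ Set.univ ≠ 0) (ht : intensityMeasure ρ Set.univ ≠ ⊤)
    (hh : Measurable (Function.uncurry h)) :
    ∫⁻ ω, averageProd h (X ω) ∂P = ∫⁻ a, ∑' n, poissonWeight ρ n *
      (invCard (n + 1) * (∫⁻ b, h a b ∂(pointLaw ρ)) ^ n) ∂(intensityMeasure ρ) := by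
  classical
  have hdec : ∀ x : Finset S2, averageProd h x =
      ∑ a ∈ x, invCard ((x.erase a).card + 1) * pointProd h a (x.erase a) := by
    intro x
    rw [averageProd, Finset.mul_sum]
    exact Finset.sum_congr rfl fun a ha => by rw [Finset.card_erase_add_one ha]
  simp_rw [hdec]
  refine (hX.mecke h0 ht (φ := fun a x => invCard (x.card + 1) * pointProd h a x) ?_).trans ?_
  · exact ((measurable_invCard_card 1).comp measurable_snd).mul (measurable_pointProd hh)
  · exact lintegral_congr fun a =>
      hX.lintegral_card_mul_prod h0 ht (fun n => invCard (n + 1)) hh.of_uncurry_left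

open scoped Classical in
/-- The contribution of the pairs of distinct points to the second moment of `averageProd`. -/
lemma IsPoissonProcess.lintegral_pointProd_mul_sum (hX : IsPoissonProcess P X ρ)
    (h0 : intensityMeasure ρ Set.univ ≠ 0) (ht : intensityMeasure ρ Set.univ ≠ ⊤)
    (hh : Measurable (Function.uncurry h)) (a : S2) :
    ∫⁻ ω, invCard ((X ω).card + 1) ^ 2 * (pointProd h a (X ω) *
        ∑ c ∈ X ω, h c a * pointProd h c ((X ω).erase c)) ∂P =
      ∫⁻ c, h a c * h c a * ∑' n, poissonWeight ρ n * (invCard (n + 2) ^ 2 *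
        (∫⁻ b, h a b * h c b ∂(pointLaw ρ)) ^ n) ∂(intensityMeasure ρ) := by
  have hdec : ∀ x : Finset S2, invCard (x.card + 1) ^ 2 * (pointProd h a x *
        ∑ c ∈ x, h c a * pointProd h c (x.erase c)) =
      ∑ c ∈ x, h a c * h c a * (invCard ((x.erase c).card + 2) ^ 2 *
        ∏ b ∈ x.erase c, h a b * h c b) := by
    intro x
    rw [Finset.mul_sum, Finset.mul_sum]
    refine Finset.sum_congr rfl fun c hc => ?_
    rw [← Finset.card_erase_add_one hc, pointProd, pointProd, ← Finset.mul_prod_erase x (h a) hc,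
      Finset.prod_mul_distrib]
    ring
  simp_rw [hdec]
  have hha : Measurable (h a) := hh.of_uncurry_left
  have hmp : Measurable fun z : S2 × Finset S2 => ∏ b ∈ z.2, h a b * h z.1 b :=
    measurable_prod_pattern (h := fun c b => h a b * h c b) ((hha.comp measurable_snd).mul hh)
  have hmecke := hX.mecke h0 ht (φ := fun c x => h a c * h c a * (invCard (x.card + 2) ^ 2 *
      ∏ b ∈ x, h a b * h c b)) (by
    refine ((hha.comp measurable_fst).mul (hh.of_uncurry_right.comp measurable_fst)).mul ?_
    exact (((measurable_invCard_card 2).comp measurable_snd).pow_const 2).mul hmp)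
  have hhm : ∀ c, Measurable fun b => h a b * h c b := fun c => hha.mul hh.of_uncurry_left
  refine hmecke.trans ?_
  refine lintegral_congr fun c => ?_
  rw [← hX.lintegral_card_mul_prod h0 ht (fun n => invCard (n + 2) ^ 2)
    (hhm c), lintegral_const_mul]
  exact (((measurable_invCard_card 2).comp hX.measurable).pow_const 2).mul
    ((measurable_prod_pattern' (hhm c)).comp hX.measurable)

/-- The second moment of `averageProd`: the two terms are the contributions of the diagonal and of
the pairs of distinct points to the square of the sum. -/
lemma IsPoissonProcess.lintegral_averageProd_sq (hX : IsPoissonProcess P X ρ)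
    (h0 : intensityMeasure ρ Set.univ ≠ 0) (ht : intensityMeasure ρ Set.univ ≠ ⊤)
    (hh : Measurable (Function.uncurry h)) :
    ∫⁻ ω, averageProd h (X ω) ^ 2 ∂P =
      (∫⁻ a, ∑' n, poissonWeight ρ n *
        (invCard (n + 1) ^ 2 * (∫⁻ b, h a b * h a b ∂(pointLaw ρ)) ^ n) ∂(intensityMeasure ρ)) +
      ∫⁻ a, ∫⁻ c, h a c * h c a * ∑' n, poissonWeight ρ n * (invCard (n + 2) ^ 2 *
        (∫⁻ b, h a b * h c b ∂(pointLaw ρ)) ^ n) ∂(intensityMeasure ρ) ∂(intensityMeasure ρ) := by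
  classical
  have hQ := measurable_pointProd hh
  have hprob := isProbabilityMeasure_pointLaw h0 ht
  -- One factor is written as a sum over the centre `a`, and `a` is split off the other factor.
  have hdec : ∀ x : Finset S2, averageProd h x ^ 2 =
      ∑ a ∈ x, invCard ((x.erase a).card + 1) ^ 2 * (pointProd h a (x.erase a) *
        (pointProd h a (x.erase a) +
          ∑ c ∈ x.erase a, h c a * pointProd h c ((x.erase a).erase c))) := by
    intro x
    rw [sq]
    conv_lhs => rw [averageProd.eq_def h x]
    rw [Finset.mul_sum, Finset.sum_mul]
    refine Finset.sum_congr rfl fun a ha => ?_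
    have := averageProd_of_mem (h := h) ha
    rw [averageProd, Finset.mul_sum] at this
    rw [this, Finset.card_erase_add_one ha]
    ring
  simp_rw [hdec]
  have hsum : Measurable fun z : S2 × Finset S2 =>
      ∑ c ∈ z.2, h c z.1 * pointProd h c (z.2.erase c) := by
    refine measurable_sum_erase_pattern (T := S2) (φ := fun a c x => h c a * pointProd h c x) ?_
    exact (hh.comp ((measurable_fst.comp measurable_snd).prodMk measurable_fst)).mul
      (hQ.comp measurable_snd)
  have hcard : Measurable fun x : Finset S2 => invCard (x.card + 1) ^ 2 :=
    (measurable_invCard_card 1).pow_const 2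
  refine (hX.mecke h0 ht (φ := fun a x => invCard (x.card + 1) ^ 2 * (pointProd h a x *
    (pointProd h a x + ∑ c ∈ x, h c a * pointProd h c (x.erase c)))) ?_).trans ?_
  · exact (hcard.comp measurable_snd).mul (hQ.mul (hQ.add hsum))
  rw [← lintegral_add_left]
  · refine lintegral_congr fun a => ?_
    have hQa : Measurable fun ω => pointProd h a (X ω) := hQ.of_uncurry_left.comp hX.measurable
    have hha : Measurable fun b => h a b * h a b := hh.of_uncurry_left.mul hh.of_uncurry_left
    have hcX : Measurable fun ω => invCard ((X ω).card + 1) ^ 2 := hcard.comp hX.measurable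
    rw [← hX.lintegral_pointProd_mul_sum h0 ht hh a,
      ← hX.lintegral_card_mul_prod h0 ht (fun n => invCard (n + 1) ^ 2)
        hha, ← lintegral_add_left]
    · refine lintegral_congr fun ω => ?_
      simp only [Finset.prod_mul_distrib]
      change _ = invCard ((X ω).card + 1) ^ 2 * (pointProd h a (X ω) * pointProd h a (X ω)) + _
      ring
    · simp only [Finset.prod_mul_distrib]
      exact hcX.mul (hQa.mul hQa)
  · refine Measurable.tsum fun n => ?_
    refine (Measurable.pow_const ?_ n).const_mul _ |>.const_mul _
    exact (hh.mul hh).lintegral_prod_right'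

end AverageOfProducts

/-! ### The variance of the estimator of the `H`-function -/

lemma measurable_uncurry_swap {α β : Type*} [MeasurableSpace α] [MeasurableSpace β]
    {f : α → α → β} (hf : Measurable (Function.uncurry f)) :
    Measurable (Function.uncurry fun a c => f c a) :=
  hf.comp measurable_swap

lemma measurable_uncurry_diag {α β : Type*} [MeasurableSpace α] [MeasurableSpace β]
    {f : α → α → β} (hf : Measurable (Function.uncurry f)) : Measurable fun a => f a a :=
  hf.comp (measurable_id.prodMk measurable_id)

lemma measurable_uncurry_lintegral_mul {α β : Type*} [MeasurableSpace α] [MeasurableSpace β]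
    {ν : Measure β} [SFinite ν] {f : α → β → ℝ≥0∞} (hf : Measurable (Function.uncurry f)) :
    Measurable (Function.uncurry fun a c => ∫⁻ b, f a b * f c b ∂ν) := by
  have h1 : Measurable fun w : (α × α) × β => f w.1.1 w.2 :=
    hf.comp ((measurable_fst.comp measurable_fst).prodMk measurable_snd)
  have h2 : Measurable fun w : (α × α) × β => f w.1.2 w.2 :=
    hf.comp ((measurable_snd.comp measurable_fst).prodMk measurable_snd)
  exact (h1.mul h2).lintegral_prod_right'

lemma measurable_uncurry_mul_mul {α : Type*} [MeasurableSpace α] {g : α → ℝ} {h : α → α → ℝ}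
    {k : α → α → ℝ} (hg : Measurable g) (hh : Measurable (Function.uncurry h))
    (hk : Measurable (Function.uncurry k)) :
    Measurable (Function.uncurry fun a c => (g a * g c) * (h a c * h c a) * k a c) :=
  (((hg.comp measurable_fst).mul (hg.comp measurable_snd)).mul
    (hh.mul (measurable_uncurry_swap hh))).mul hk

lemma nonneg_of_div_nonneg {a b : ℝ} (hb : 0 < b) (h : 0 ≤ a / b) : 0 ≤ a := by
  simpa [div_mul_cancel₀ _ hb.ne'] using mul_nonneg h hb.le

section H

variable {ρ : S2 → ℝ} {r : ℝ}

lemma A1_le_one (hρ_meas : Measurable ρ) (hρ_int : Integrable ρ area)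
    (hρ_pos : 0 < infIntensity ρ) (hr : r ∈ Set.Icc 0 Real.pi) (a c : S2) : A1 ρ r a c ≤ 1 := by
  rw [← integral_mul_capFactor_mul hρ_meas hρ_int hρ_pos hr,
    div_le_one (totalMass_pos hρ_int hρ_pos)]
  refine integral_mono (integrable_mul_capFactor_mul hρ_meas hρ_int hρ_pos a c) hρ_int fun b => ?_
  exact mul_le_of_le_one_right (pos_of_infIntensity_pos hρ_pos b).le
    (mul_le_one₀ (capFactor_le_one hρ_pos a b) (capFactor_nonneg hρ_pos c b)
      (capFactor_le_one hρ_pos c b))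

lemma A1_mem_Icc (hρ_meas : Measurable ρ) (hρ_int : Integrable ρ area)
    (hρ_pos : 0 < infIntensity ρ) (hr : r ∈ Set.Icc 0 Real.pi) (a c : S2) :
    A1 ρ r a c ∈ Set.Icc (0 : ℝ) 1 :=
  ⟨A1_nonneg hρ_meas hρ_int hρ_pos hr a c, A1_le_one hρ_meas hρ_int hρ_pos hr a c⟩

lemma measurable_A1 (hρ_meas : Measurable ρ) (hρ_int : Integrable ρ area)
    (hρ_pos : 0 < infIntensity ρ) (hr : r ∈ Set.Icc 0 Real.pi) :
    Measurable (Function.uncurry (A1 ρ r)) := by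
  have := isProbabilityMeasure_pointLaw (intensityMeasure_univ_ne_zero hρ_int hρ_pos)
    (intensityMeasure_univ_ne_top hρ_int hρ_pos)
  have hm : Measurable (Function.uncurry fun a b => ENNReal.ofReal (capFactor ρ r a b)) :=
    (measurable_capFactor hρ_meas).ennreal_ofReal
  have h3 := measurable_uncurry_lintegral_mul (ν := pointLaw ρ) hm
  simp_rw [lintegral_capFactor_mul hρ_meas hρ_int hρ_pos hr] at h3
  have h4 : A1 ρ r = fun a c => (ENNReal.ofReal (A1 ρ r a c)).toReal := by
    funext a c
    rw [ENNReal.toReal_ofReal (A1_nonneg hρ_meas hρ_int hρ_pos hr _ _)]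
  rw [h4]
  exact h3.ennreal_toReal

lemma one_div_add_sq_mem_Icc (k n : ℕ) (hk : 1 ≤ k) :
    1 / ((n : ℝ) + k) ^ 2 ∈ Set.Icc (0 : ℝ) 1 := by
  have h : (1 : ℝ) ≤ n + k := by
    have : (1 : ℝ) ≤ k := by exact_mod_cast hk
    linarith [(Nat.cast_nonneg n : (0 : ℝ) ≤ n)]
  refine ⟨by positivity, ?_⟩
  rw [div_le_one (by positivity)]
  exact one_le_pow₀ h

lemma psi1_mem_Icc {m A : ℝ} (hm : 0 < m) (hA : A ∈ Set.Icc (0 : ℝ) 1) :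
    psi1 m A / m ^ 2 ∈ Set.Icc (0 : ℝ) 1 :=
  mem_Icc_of_hasSum_poisson hm hA
    (fun n => by simpa using one_div_add_sq_mem_Icc 2 n one_le_two) (hasSum_psi1 hm hA.1)

lemma psi2_mem_Icc {m A : ℝ} (hm : 0 < m) (hA : A ∈ Set.Icc (0 : ℝ) 1) :
    psi2 m A / m ∈ Set.Icc (0 : ℝ) 1 :=
  mem_Icc_of_hasSum_poisson hm hA
    (fun n => by simpa using one_div_add_sq_mem_Icc 1 n le_rfl) (hasSum_psi2 hm hA.1)

/-- The series make the `ψᵢ` measurable functions of `A`, without recourse to `Ei`. -/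
lemma measurable_tsum_poisson {T : Type*} [MeasurableSpace T] {A : T → ℝ} (hA : Measurable A)
    (m : ℝ) (g : ℕ → ℝ) :
    Measurable fun t => ∑' n : ℕ, Real.exp (-m) * m ^ n / n.factorial * (g n * A t ^ n) :=
  Measurable.tsum fun n => ((hA.pow_const n).const_mul _).const_mul _

lemma measurable_psi1_A1 (hρ_meas : Measurable ρ) (hρ_int : Integrable ρ area)
    (hρ_pos : 0 < infIntensity ρ) (hr : r ∈ Set.Icc 0 Real.pi) :
    Measurable (Function.uncurry fun a c => psi1 (totalMass ρ) (A1 ρ r a c)) := by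
  have hΛ := totalMass_pos hρ_int hρ_pos
  have h := (measurable_tsum_poisson (measurable_A1 hρ_meas hρ_int hρ_pos hr) (totalMass ρ)
    fun n => 1 / ((n : ℝ) + 2) ^ 2).const_mul (totalMass ρ ^ 2)
  convert h using 2 with z
  simp only [Function.uncurry]
  rw [(hasSum_psi1 hΛ (A1_nonneg hρ_meas hρ_int hρ_pos hr _ _)).tsum_eq,
    mul_div_cancel₀ _ (by positivity)]

lemma measurable_psi2_A2 (hρ_meas : Measurable ρ) (hρ_int : Integrable ρ area)
    (hρ_pos : 0 < infIntensity ρ) (hr : r ∈ Set.Icc 0 Real.pi) :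
    Measurable fun a : S2 => psi2 (totalMass ρ) (A2 ρ r a) := by
  have hΛ := totalMass_pos hρ_int hρ_pos
  have hdiag := measurable_uncurry_diag (measurable_A1 hρ_meas hρ_int hρ_pos hr)
  have h := (measurable_tsum_poisson hdiag (totalMass ρ)
    fun n => 1 / ((n : ℝ) + 1) ^ 2).const_mul (totalMass ρ)
  convert h using 2 with a
  rw [A2_eq, (hasSum_psi2 hΛ (A1_nonneg hρ_meas hρ_int hρ_pos hr _ _)).tsum_eq,
    mul_div_cancel₀ _ hΛ.ne']

lemma integrandH1_eq (hρ_pos : 0 < infIntensity ρ) (a c : S2) :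
    integrandH1 ρ r a c = (ρ a * ρ c) * (capFactor ρ r a c * capFactor ρ r c a) *
      psi1 (totalMass ρ) (A1 ρ r a c) := by
  rw [integrandH1, ← mul_capFactor hρ_pos, ← mul_capFactor hρ_pos]
  ring

lemma integrandH1_nonneg (hρ_meas : Measurable ρ) (hρ_int : Integrable ρ area)
    (hρ_pos : 0 < infIntensity ρ) (hr : r ∈ Set.Icc 0 Real.pi) (a c : S2) :
    0 ≤ integrandH1 ρ r a c := by
  have hΛ := totalMass_pos hρ_int hρ_pos
  have h := (psi1_mem_Icc hΛ (A1_mem_Icc hρ_meas hρ_int hρ_pos hr a c)).1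
  rw [integrandH1_eq hρ_pos]
  refine mul_nonneg (mul_nonneg (mul_nonneg ?_ ?_) (mul_nonneg ?_ ?_)) ?_
  · exact (pos_of_infIntensity_pos hρ_pos a).le
  · exact (pos_of_infIntensity_pos hρ_pos c).le
  · exact capFactor_nonneg hρ_pos _ _
  · exact capFactor_nonneg hρ_pos _ _
  · exact nonneg_of_div_nonneg (by positivity) h

lemma integrandH2_nonneg (hρ_meas : Measurable ρ) (hρ_int : Integrable ρ area)
    (hρ_pos : 0 < infIntensity ρ) (hr : r ∈ Set.Icc 0 Real.pi) (a : S2) :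
    0 ≤ integrandH2 ρ r a := by
  have hΛ := totalMass_pos hρ_int hρ_pos
  have h := (psi2_mem_Icc hΛ (A1_mem_Icc hρ_meas hρ_int hρ_pos hr a a)).1
  rw [integrandH2, A2_eq]
  exact mul_nonneg (nonneg_of_div_nonneg hΛ h) (pos_of_infIntensity_pos hρ_pos a).le

lemma measurable_integrandH1 (hρ_meas : Measurable ρ) (hρ_int : Integrable ρ area)
    (hρ_pos : 0 < infIntensity ρ) (hr : r ∈ Set.Icc 0 Real.pi) :
    Measurable (Function.uncurry (integrandH1 ρ r)) := by
  have h := measurable_uncurry_mul_mul hρ_meas (measurable_capFactor (r := r) hρ_meas)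
    (measurable_psi1_A1 hρ_meas hρ_int hρ_pos hr)
  simp_rw [← integrandH1_eq hρ_pos] at h
  exact h

lemma integrable_integrandH1 (hρ_meas : Measurable ρ) (hρ_int : Integrable ρ area)
    (hρ_pos : 0 < infIntensity ρ) (hr : r ∈ Set.Icc 0 Real.pi) :
    Integrable (fun z : S2 × S2 => integrandH1 ρ r z.1 z.2) (area.prod area) := by
  have hΛ := totalMass_pos hρ_int hρ_pos
  refine ((hρ_int.mul_prod hρ_int).mul_const (totalMass ρ ^ 2)).mono'
    (measurable_integrandH1 hρ_meas hρ_int hρ_pos hr).aestronglyMeasurable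
    (Eventually.of_forall fun z => ?_)
  rw [Real.norm_of_nonneg (integrandH1_nonneg hρ_meas hρ_int hρ_pos hr _ _),
    integrandH1_eq hρ_pos]
  have h := psi1_mem_Icc hΛ (A1_mem_Icc hρ_meas hρ_int hρ_pos hr z.1 z.2)
  have h2 : psi1 (totalMass ρ) (A1 ρ r z.1 z.2) ≤ totalMass ρ ^ 2 :=
    (div_le_one (by positivity)).1 h.2
  have h1 : 0 ≤ psi1 (totalMass ρ) (A1 ρ r z.1 z.2) :=
    nonneg_of_div_nonneg (by positivity) h.1
  have ha := pos_of_infIntensity_pos hρ_pos z.1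
  have hc := pos_of_infIntensity_pos hρ_pos z.2
  refine mul_le_mul (mul_le_of_le_one_right (by positivity) ?_) h2 h1 (by positivity)
  exact mul_le_one₀ (capFactor_le_one hρ_pos _ _) (capFactor_nonneg hρ_pos _ _)
    (capFactor_le_one hρ_pos _ _)

lemma measurable_integrandH2 (hρ_meas : Measurable ρ) (hρ_int : Integrable ρ area)
    (hρ_pos : 0 < infIntensity ρ) (hr : r ∈ Set.Icc 0 Real.pi) :
    Measurable (integrandH2 ρ r) :=
  (measurable_psi2_A2 hρ_meas hρ_int hρ_pos hr).mul hρ_meas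

lemma integrable_integrandH2 (hρ_meas : Measurable ρ) (hρ_int : Integrable ρ area)
    (hρ_pos : 0 < infIntensity ρ) (hr : r ∈ Set.Icc 0 Real.pi) :
    Integrable (integrandH2 ρ r) area := by
  have hΛ := totalMass_pos hρ_int hρ_pos
  refine (hρ_int.const_mul (totalMass ρ)).mono'
    (measurable_integrandH2 hρ_meas hρ_int hρ_pos hr).aestronglyMeasurable
    (Eventually.of_forall fun a => ?_)
  rw [Real.norm_of_nonneg (integrandH2_nonneg hρ_meas hρ_int hρ_pos hr _), integrandH2, A2_eq]
  have h := psi2_mem_Icc hΛ (A1_mem_Icc hρ_meas hρ_int hρ_pos hr a a)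
  exact mul_le_mul_of_nonneg_right ((div_le_one hΛ).1 h.2) (pos_of_infIntensity_pos hρ_pos a).le

lemma invCard_sq (n k : ℕ) : invCard (n + k) ^ 2 = ENNReal.ofReal (1 / ((n : ℝ) + k) ^ 2) := by
  rw [invCard, ← ENNReal.ofReal_pow (by positivity)]
  congr 1
  push_cast
  rw [div_pow, one_pow]

variable {Ω : Type*} [MeasurableSpace Ω] {P : Measure Ω} [IsProbabilityMeasure P]
  {X : Ω → Finset S2}

lemma lintegral_averageProd_capFactor (hρ_meas : Measurable ρ) (hρ_int : Integrable ρ area)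
    (hρ_pos : 0 < infIntensity ρ) (hX : IsPoissonProcess P X ρ) (hr : r ∈ Set.Icc 0 Real.pi) :
    ∫⁻ ω, averageProd (fun a b => ENNReal.ofReal (capFactor ρ r a b)) (X ω) ∂P =
      ENNReal.ofReal (psi3 (totalMass ρ) (Cconst ρ r)) := by
  have hΛ := totalMass_pos hρ_int hρ_pos
  have hm : Measurable (Function.uncurry fun a b => ENNReal.ofReal (capFactor ρ r a b)) :=
    (measurable_capFactor hρ_meas).ennreal_ofReal
  rw [hX.lintegral_averageProd (intensityMeasure_univ_ne_zero hρ_int hρ_pos)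
    (intensityMeasure_univ_ne_top hρ_int hρ_pos) hm]
  simp_rw [lintegral_capFactor hρ_meas hρ_int hρ_pos hr]
  have hC := Cconst_nonneg hρ_int hρ_pos hr
  have h3 := hasSum_psi3 hΛ hC
  have hs : ∀ n : ℕ, invCard (n + 1) = ENNReal.ofReal (1 / ((n : ℝ) + 1)) := fun n => by
    rw [invCard]; push_cast; rfl
  simp_rw [hs]
  rw [tsum_poissonWeight hρ_int hρ_pos (fun n => by positivity) hC h3, lintegral_const,
    intensityMeasure_univ hρ_int hρ_pos, ← ENNReal.ofReal_mul' hΛ.le, div_mul_cancel₀ _ hΛ.ne']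

lemma lintegral_averageProd_capFactor_sq (hρ_meas : Measurable ρ) (hρ_int : Integrable ρ area)
    (hρ_pos : 0 < infIntensity ρ) (hX : IsPoissonProcess P X ρ) (hr : r ∈ Set.Icc 0 Real.pi) :
    ∫⁻ ω, averageProd (fun a b => ENNReal.ofReal (capFactor ρ r a b)) (X ω) ^ 2 ∂P =
      ENNReal.ofReal (1 / totalMass ρ ^ 2 * (∫ y, ∫ x, integrandH1 ρ r x y ∂area ∂area)
        + 1 / totalMass ρ * (∫ x, integrandH2 ρ r x ∂area)) := by
  have hΛ := totalMass_pos hρ_int hρ_pos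
  have := isFiniteMeasure_intensityMeasure hρ_int hρ_pos
  have hm : Measurable (Function.uncurry fun a b => ENNReal.ofReal (capFactor ρ r a b)) :=
    (measurable_capFactor hρ_meas).ennreal_ofReal
  have hm' := measurable_uncurry_swap hm
  have hA := A1_nonneg hρ_meas hρ_int hρ_pos hr
  rw [hX.lintegral_averageProd_sq (intensityMeasure_univ_ne_zero hρ_int hρ_pos)
    (intensityMeasure_univ_ne_top hρ_int hρ_pos) hm]
  simp_rw [lintegral_capFactor_mul hρ_meas hρ_int hρ_pos hr, invCard_sq]
  have ht1 : ∀ a, ∑' n : ℕ, poissonWeight ρ n * (ENNReal.ofReal (1 / ((n : ℝ) + (1 : ℕ)) ^ 2) *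
      ENNReal.ofReal (A1 ρ r a a) ^ n) =
      ENNReal.ofReal (psi2 (totalMass ρ) (A2 ρ r a) / totalMass ρ) := by
    intro a
    rw [A2_eq]
    exact tsum_poissonWeight hρ_int hρ_pos (fun n => by positivity) (hA a a)
      (by simpa using hasSum_psi2 hΛ (hA a a))
  have ht2 : ∀ a c, ∑' n : ℕ, poissonWeight ρ n * (ENNReal.ofReal (1 / ((n : ℝ) + (2 : ℕ)) ^ 2) *
      ENNReal.ofReal (A1 ρ r a c) ^ n) =
      ENNReal.ofReal (psi1 (totalMass ρ) (A1 ρ r a c) / totalMass ρ ^ 2) := by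
    intro a c
    exact tsum_poissonWeight hρ_int hρ_pos (fun n => by positivity) (hA a c)
      (by simpa using hasSum_psi1 hΛ (hA a c))
  simp_rw [ht1, ht2]
  have hI1 : ∫ y, ∫ x, integrandH1 ρ r x y ∂area ∂area =
      ∫ z : S2 × S2, integrandH1 ρ r z.1 z.2 ∂(area.prod area) :=
    (integral_prod_symm _ (integrable_integrandH1 hρ_meas hρ_int hρ_pos hr)).symm
  rw [hI1, ← integral_const_mul, ← integral_const_mul, add_comm,
    ENNReal.ofReal_add
      (integral_nonneg fun z => mul_nonneg (by positivity)
        (integrandH1_nonneg hρ_meas hρ_int hρ_pos hr _ _))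
      (integral_nonneg fun x => mul_nonneg (by positivity)
        (integrandH2_nonneg hρ_meas hρ_int hρ_pos hr _)),
    ofReal_integral_eq_lintegral_ofReal
      ((integrable_integrandH1 hρ_meas hρ_int hρ_pos hr).const_mul _)
      (Eventually.of_forall fun z => mul_nonneg (by positivity)
        (integrandH1_nonneg hρ_meas hρ_int hρ_pos hr _ _)),
    ofReal_integral_eq_lintegral_ofReal
      ((integrable_integrandH2 hρ_meas hρ_int hρ_pos hr).const_mul _)
      (Eventually.of_forall fun z => mul_nonneg (by positivity)
        (integrandH2_nonneg hρ_meas hρ_int hρ_pos hr _))]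
  congr 1
  · have hpsi : Measurable (Function.uncurry fun a c =>
        ENNReal.ofReal (psi1 (totalMass ρ) (A1 ρ r a c) / totalMass ρ ^ 2)) :=
      ((measurable_psi1_A1 hρ_meas hρ_int hρ_pos hr).div_const _).ennreal_ofReal
    have hF : Measurable (Function.uncurry fun a c : S2 => ENNReal.ofReal (capFactor ρ r a c) *
        ENNReal.ofReal (capFactor ρ r c a) *
        ENNReal.ofReal (psi1 (totalMass ρ) (A1 ρ r a c) / totalMass ρ ^ 2)) :=
      (hm.mul hm').mul hpsi
    have hFi := hF.lintegral_prod_right (ν := intensityMeasure ρ)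
    have hH : Measurable fun z : S2 × S2 =>
        ENNReal.ofReal (1 / totalMass ρ ^ 2 * integrandH1 ρ r z.1 z.2) :=
      ((measurable_integrandH1 hρ_meas hρ_int hρ_pos hr).const_mul _).ennreal_ofReal
    rw [lintegral_intensityMeasure hρ_meas hFi, lintegral_prod _ hH.aemeasurable]
    refine lintegral_congr fun a => ?_
    have hFa : Measurable fun c : S2 => ENNReal.ofReal (capFactor ρ r a c) *
        ENNReal.ofReal (capFactor ρ r c a) *
        ENNReal.ofReal (psi1 (totalMass ρ) (A1 ρ r a c) / totalMass ρ ^ 2) := hF.of_uncurry_left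
    rw [lintegral_intensityMeasure hρ_meas hFa, ← lintegral_const_mul _ (by fun_prop)]
    refine lintegral_congr fun c => ?_
    have ha := pos_of_infIntensity_pos hρ_pos a
    have hc := pos_of_infIntensity_pos hρ_pos c
    have h1 := capFactor_nonneg (r := r) hρ_pos a c
    have h2 := capFactor_nonneg (r := r) hρ_pos c a
    rw [← ENNReal.ofReal_mul h1, ← ENNReal.ofReal_mul (mul_nonneg h1 h2),
      ← ENNReal.ofReal_mul hc.le, ← ENNReal.ofReal_mul ha.le, integrandH1_eq hρ_pos]
    congr 1
    ring
  · rw [lintegral_intensityMeasure hρ_meas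
      ((measurable_psi2_A2 hρ_meas hρ_int hρ_pos hr).div_const _).ennreal_ofReal]
    refine lintegral_congr fun a => ?_
    rw [← ENNReal.ofReal_mul (pos_of_infIntensity_pos hρ_pos a).le, integrandH2]
    congr 1
    ring

lemma averageProd_empty (h : S2 → S2 → ℝ≥0∞) : averageProd h ∅ = 0 := by
  simp [averageProd]

/-- The indicator of the empty pattern. -/
def emptyInd (x : Finset S2) : ℝ≥0∞ := if x.card = 0 then 1 else 0

lemma measurable_emptyInd : Measurable emptyInd :=
  (measurable_of_countable fun n : ℕ => if n = 0 then (1 : ℝ≥0∞) else 0).comp measurable_card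

lemma lintegral_emptyInd (hρ_int : Integrable ρ area)
    (hρ_pos : 0 < infIntensity ρ) (hX : IsPoissonProcess P X ρ) :
    ∫⁻ ω, emptyInd (X ω) ∂P = ENNReal.ofReal (Real.exp (-totalMass ρ)) := by
  have h := hX.lintegral_card_mul_prod (intensityMeasure_univ_ne_zero hρ_int hρ_pos)
    (intensityMeasure_univ_ne_top hρ_int hρ_pos) (fun n => if n = 0 then 1 else 0)
    (h := fun _ => 1) measurable_const
  simp only [Finset.prod_const_one, mul_one] at h
  refine h.trans ?_
  rw [tsum_eq_single 0 fun n hn => by simp [hn], poissonWeight_eq hρ_int hρ_pos]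
  simp

lemma Hhat_eq (hρ_pos : 0 < infIntensity ρ) {e : ℝ} (he : e ≤ 1) (x : Finset S2) :
    Hhat e ρ r x = 1 - (averageProd (fun a b => ENNReal.ofReal (capFactor ρ r a b)) x +
      ENNReal.ofReal (1 - e) * emptyInd x).toReal := by
  rcases x.eq_empty_or_nonempty with rfl | hx
  · simp [Hhat, averageProd_empty, emptyInd, ENNReal.toReal_ofReal (sub_nonneg.2 he)]
  · rw [Hhat, if_neg hx.ne_empty, emptyInd, if_neg hx.card_pos.ne', mul_zero, add_zero,
      averageProd, ENNReal.toReal_mul, invCard, ENNReal.toReal_ofReal (by positivity)]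
    simp only [pointProd]
    rw [ENNReal.toReal_sum fun a _ => ENNReal.prod_ne_top fun b _ => ENNReal.ofReal_ne_top,
      div_eq_inv_mul, one_div]
    congr 2
    refine Finset.sum_congr rfl fun a _ => ?_
    rw [ENNReal.toReal_prod]
    exact Finset.prod_congr rfl fun b _ =>
      (ENNReal.toReal_ofReal (capFactor_nonneg hρ_pos a b)).symm

/-- The variance of the estimator that takes the value `e ≤ 1` at the empty pattern. -/
lemma variance_Hhat (hρ_meas : Measurable ρ) (hρ_int : Integrable ρ area)
    (hρ_pos : 0 < infIntensity ρ) (hX : IsPoissonProcess P X ρ) (hr : r ∈ Set.Icc 0 Real.pi)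
    {e : ℝ} (he : e ≤ 1) :
    MemLp (fun ω => Hhat e ρ r (X ω)) 2 P ∧
      variance (fun ω => Hhat e ρ r (X ω)) P = varH ρ r +
        (1 - e) ^ 2 * (Real.exp (-totalMass ρ) * (1 - Real.exp (-totalMass ρ))) -
        2 * (1 - e) * Real.exp (-totalMass ρ) * psi3 (totalMass ρ) (Cconst ρ r) := by
  have hΛ := totalMass_pos hρ_int hρ_pos
  have hd : 0 ≤ 1 - e := sub_nonneg.2 he
  have hm : Measurable (Function.uncurry fun a b => ENNReal.ofReal (capFactor ρ r a b)) :=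
    (measurable_capFactor hρ_meas).ennreal_ofReal
  have hY : Measurable fun ω =>
      averageProd (fun a b => ENNReal.ofReal (capFactor ρ r a b)) (X ω) :=
    (measurable_averageProd hm).comp hX.measurable
  have hE : Measurable fun ω => emptyInd (X ω) := measurable_emptyInd.comp hX.measurable
  have hpsi3 : 0 ≤ psi3 (totalMass ρ) (Cconst ρ r) := by
    have h := (hasSum_psi3 hΛ (Cconst_nonneg hρ_int hρ_pos hr)).nonneg fun n =>
      mul_nonneg (by positivity) (mul_nonneg (by positivity)
        (pow_nonneg (Cconst_nonneg hρ_int hρ_pos hr) n))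
    exact nonneg_of_div_nonneg hΛ h
  have hS : 0 ≤ 1 / totalMass ρ ^ 2 * (∫ y, ∫ x, integrandH1 ρ r x y ∂area ∂area)
        + 1 / totalMass ρ * (∫ x, integrandH2 ρ r x ∂area) := by
    refine add_nonneg (mul_nonneg (by positivity) ?_) (mul_nonneg (by positivity) ?_)
    · exact integral_nonneg fun y => integral_nonneg fun x =>
        integrandH1_nonneg hρ_meas hρ_int hρ_pos hr x y
    · exact integral_nonneg fun x => integrandH2_nonneg hρ_meas hρ_int hρ_pos hr x
  have h1 : ∫⁻ ω, (averageProd (fun a b => ENNReal.ofReal (capFactor ρ r a b)) (X ω) +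
      ENNReal.ofReal (1 - e) * emptyInd (X ω)) ∂P =
      ENNReal.ofReal (psi3 (totalMass ρ) (Cconst ρ r) +
        (1 - e) * Real.exp (-totalMass ρ)) := by
    rw [lintegral_add_left hY, lintegral_const_mul _ hE, lintegral_emptyInd hρ_int hρ_pos hX,
      lintegral_averageProd_capFactor hρ_meas hρ_int hρ_pos hX hr, ← ENNReal.ofReal_mul hd,
      ← ENNReal.ofReal_add hpsi3 (by positivity)]
  -- The cross term vanishes, since the average over the empty pattern is `0`.
  have hsq : ∀ ω, (averageProd (fun a b => ENNReal.ofReal (capFactor ρ r a b)) (X ω) +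
      ENNReal.ofReal (1 - e) * emptyInd (X ω)) ^ 2 =
      averageProd (fun a b => ENNReal.ofReal (capFactor ρ r a b)) (X ω) ^ 2 +
      ENNReal.ofReal ((1 - e) ^ 2) * emptyInd (X ω) := by
    intro ω
    rcases (X ω).eq_empty_or_nonempty with h | h
    · simp [h, averageProd_empty, emptyInd, ENNReal.ofReal_pow hd]
    · simp [emptyInd, h.ne_empty]
  have h2 : ∫⁻ ω, (averageProd (fun a b => ENNReal.ofReal (capFactor ρ r a b)) (X ω) +
      ENNReal.ofReal (1 - e) * emptyInd (X ω)) ^ 2 ∂P =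
      ENNReal.ofReal ((1 / totalMass ρ ^ 2 * (∫ y, ∫ x, integrandH1 ρ r x y ∂area ∂area)
        + 1 / totalMass ρ * (∫ x, integrandH2 ρ r x ∂area)) +
        (1 - e) ^ 2 * Real.exp (-totalMass ρ)) := by
    simp_rw [hsq]
    rw [lintegral_add_left (hY.pow_const 2), lintegral_const_mul _ hE,
      lintegral_emptyInd hρ_int hρ_pos hX,
      lintegral_averageProd_capFactor_sq hρ_meas hρ_int hρ_pos hX hr,
      ← ENNReal.ofReal_mul (by positivity), ← ENNReal.ofReal_add hS (by positivity)]
  have hYE : Measurable fun ω => averageProd (fun a b => ENNReal.ofReal (capFactor ρ r a b)) (X ω) +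
      ENNReal.ofReal (1 - e) * emptyInd (X ω) := hY.add (hE.const_mul _)
  have hvar := variance_toReal hYE (by positivity)
    (add_nonneg hS (by positivity)) h1 h2
  simp_rw [Hhat_eq hρ_pos he]
  refine ⟨(memLp_const 1).sub hvar.1, ?_⟩
  rw [variance_const_sub hvar.1.aestronglyMeasurable]
  refine hvar.2.trans ?_
  rw [varH]
  ring

end H

end SphericalPoisson

end

open SphericalPoisson in
theorem mainTheorem3 {Ω : Type*} [MeasurableSpace Ω] (P : Measure Ω) [IsProbabilityMeasure P]
    (X : Ω → Finset S2) (ρ : S2 → ℝ) (hρ_meas : Measurable ρ) (hρ_int : Integrable ρ area)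
    (hρ_pos : 0 < infIntensity ρ) (hX : IsPoissonProcess P X ρ)
    (G : Finset S2) (hG : G.Nonempty) (r : ℝ) (hr : r ∈ Set.Icc 0 Real.pi) :
    -- the estimator of K
    (MemLp (fun ω => Khat ρ r (X ω)) 2 P ∧
      Integrable
        (fun z : S2 × S2 => (if geoDist z.1 z.2 ≤ r then (1 : ℝ) else 0) / (ρ z.1 * ρ z.2))
        (area.prod area) ∧
      Integrable (fun x => 1 / ρ x) area ∧
      variance (fun ω => Khat ρ r (X ω)) P =
        1 / (8 * Real.pi ^ 2) *
          (∫ y, ∫ x, (if geoDist x y ≤ r then (1 : ℝ) else 0) / (ρ x * ρ y) ∂area ∂area)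
        + (1 - Real.cos r) ^ 2 * ∫ x, 1 / ρ x ∂area) ∧
    -- the estimator of F
    (MemLp (fun ω => Fhat ρ G r (X ω)) 2 P ∧
      ∀ o : S2, variance (fun ω => Fhat ρ G r (X ω)) P =
        Real.exp (-2 * infIntensity ρ * area.real (cap o r)) / (G.card : ℝ) ^ 2 *
          (∑ p ∈ G, ∑ p' ∈ G,
            Real.exp (∫ x in cap p r ∩ cap p' r, infIntensity ρ ^ 2 / ρ x ∂area))
        - Real.exp (-2 * infIntensity ρ * area.real (cap o r))) ∧
    -- the functions in the formula for H are well defined and integrable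
    ((∀ x y, 0 ≤ A1 ρ r x y) ∧ (∀ x, 0 ≤ A2 ρ r x) ∧
      ((r < Real.pi ∨ ¬ ∀ᵐ x ∂area, ρ x = infIntensity ρ) →
        (∀ x, 0 < A2 ρ r x) ∧ 0 < Cconst ρ r) ∧
      Integrable (fun z : S2 × S2 => integrandH1 ρ r z.1 z.2) (area.prod area) ∧
      Integrable (integrandH2 ρ r) area) ∧
    -- the estimator of H with the value 1 for the empty pattern
    (MemLp (fun ω => Hhat 1 ρ r (X ω)) 2 P ∧
      variance (fun ω => Hhat 1 ρ r (X ω)) P = varH ρ r) ∧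
    -- the estimator of H with the value 0 for the empty pattern
    (MemLp (fun ω => Hhat 0 ρ r (X ω)) 2 P ∧
      variance (fun ω => Hhat 0 ρ r (X ω)) P =
        varH ρ r + Real.exp (-totalMass ρ) * (1 - Real.exp (-totalMass ρ))
          - 2 * Real.exp (-totalMass ρ) * psi3 (totalMass ρ) (Cconst ρ r)) := by
  have H1 := variance_Hhat hρ_meas hρ_int hρ_pos hX hr le_rfl
  have H0 := variance_Hhat hρ_meas hρ_int hρ_pos hX hr zero_le_one
  have K := variance_Khat hρ_meas hρ_int hρ_pos hX hr
  refine ⟨⟨K.1, integrable_kernelK hρ_meas hρ_pos, integrable_one_div hρ_meas hρ_pos, K.2⟩,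
    variance_Fhat hρ_meas hρ_int hρ_pos hX hr hG,
    ⟨A1_nonneg hρ_meas hρ_int hρ_pos hr, fun x => ?_,
      fun h => ⟨A2_pos hρ_meas hρ_int hρ_pos hr h, Cconst_pos hρ_meas hρ_int hρ_pos hr h⟩,
      integrable_integrandH1 hρ_meas hρ_int hρ_pos hr,
      integrable_integrandH2 hρ_meas hρ_int hρ_pos hr⟩, ⟨H1.1, ?_⟩, ⟨H0.1, ?_⟩⟩
  · rw [A2_eq]
    exact A1_nonneg hρ_meas hρ_int hρ_pos hr x x
  · rw [H1.2]
    ring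
  · rw [H0.2]
    ring
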